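/- Let $T\in M(n;\mathbb{C})$ be a matrix (not assumed symmetric; in particular $T$ may be singular) whose imaginary part is positive definite, i.e. $v^t(\mathrm{Im}\,T)v>0$ for all $0\neq v\in\mathbb{R}^n$, and let $\delta\in M(n;\mathbb{Z})$ be such that $\det(T-\delta)\neq 0$. Put $T':=(-T+\delta)^{-1}$; then $\det \mathrm{Im}\,T'\neq 0$. Consider the complex tori $T^{2n}_{J=T}:=\mathbb{C}^n/2\pi(\mathbb{Z}^n\oplus T\mathbb{Z}^n)$ and $T^{2n}_{J=T'}:=\mathbb{C}^n/2\pi(\mathbb{Z}^n\oplus T'\mathbb{Z}^n)$, the biholomorphic map $\varphi:T^{2n}_{J=T}\to T^{2n}_{J=T'}$, $\varphi(z)=T'z$, and write $Z=X+T'Y$ with $X,Y\in\mathbb{R}^n$ for the coordinates of $T^{2n}_{J=T'}$. Let $r\ge 1$ be an integer, $A=(a_{ij})\in M(n;\mathbb{Z})$, $p,q\in\mathbb{R}^n$ and $\mu:=p+T'^{\,t}q\in\mathbb{C}^n$. Let $\mathrm{diag}(\tilde a_1,\dots,\tilde a_n)$ with $\tilde a_i\ge 0$ and $\tilde a_i\mid\tilde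 a_{i+1}$ be the elementary divisor form of $A$ under $GL(n;\mathbb{Z})\times GL(n;\mathbb{Z})$, let $r_i'$ be the denominator of $\tilde a_i/r$ in lowest terms, and $r':=r_1'\cdots r_n'$. Let $\zeta=e^{2\pi\mathbf{i}/r}$ and let $\mathcal{U}$ consist of unitary matrices $V_j,U_k\in U(r')$ $(j,k=1,\dots,n)$ with $$V_jV_k=V_kV_j,\qquad U_jU_k=U_kU_j,\qquad \zeta^{-a_{kj}}U_kV_j=V_jU_k .$$ Let $E_{(r,A,\mu,\mathcal{U})}\to T^{2n}_{J=T'}$ be the smooth complex vector bundle of rank $r'$ whose sections $s$ satisfy $$s(\dots,X_j+2\pi,\dots,Y)=e^{\frac{\mathbf{i}}{r}\sum_i a_{ij}Y_i}\,V_j\,s(X,Y),\qquad s(X,\dots,Y_k+2\pi,\dots)=U_k\,s(X,Y),$$ equipped with the connection $$\nabla_{(r,A,\mu,\mathcal{U})}=d-\frac{\mathbf{i}}{2\pi}\Bigl(\frac1r X^tA^t+\frac1r\mu^t\Bigr)dY\cdot I_{r'} .$$ Then the pulled-back complex vector bundle $\varphi^*E_{(r,A,\mu,\mathcal{U})}\to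 T^{2n}_{J=T}$ is holomorphic if and only if $AT'=(AT')^t$. Here "holomorphic" may be understood in either of the following two senses, and the equivalence holds for both: 1. $\varphi^*E_{(r,A,\mu,\mathcal{U})}$ with its connection $\varphi^*\nabla_{(r,A,\mu,\mathcal{U})}$ is a holomorphic vector bundle, i.e. the smooth bundle has a holomorphic structure (an atlas of smooth local frames with holomorphic transition matrices) whose Dolbeault operator is the $(0,1)$-part of $\varphi^*\nabla_{(r,A,\mu,\mathcal{U})}$; 2. the smooth complex vector bundle $\varphi^*E_{(r,A,\mu,\mathcal{U})}$ admits some holomorphic structure. -/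

import Mathlib

open scoped ContDiff Matrix

/-! ### Complex tori `ℂⁿ / 2π(ℤⁿ ⊕ Tℤⁿ)` -/

/-- The imaginary part of `T` is positive definite: `vᵗ (Im T) v > 0` for all real `v ≠ 0`
(the matrix `T` is not assumed to be symmetric). -/
def ImPosDef {n : ℕ} (T : Matrix (Fin n) (Fin n) ℂ) : Prop :=
  ∀ v : Fin n → ℝ, v ≠ 0 → 0 < v ⬝ᵥ (T.map Complex.im *ᵥ v)

/-- The lattice vector `2π (m + T k)` attached to `(m, k) ∈ ℤⁿ × ℤⁿ`. -/
noncomputable def period {n : ℕ} (T : Matrix (Fin n) (Fin n) ℂ) :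
    ((Fin n → ℤ) × (Fin n → ℤ)) →+ (Fin n → ℂ) where
  toFun l := (2 * Real.pi : ℂ) • ((fun i => (l.1 i : ℂ)) + T *ᵥ (fun i => (l.2 i : ℂ)))
  map_zero' := by
    funext i
    simp [Matrix.mulVec, dotProduct]
  map_add' a b := by
    funext i
    simp only [Matrix.mulVec, dotProduct, Pi.smul_apply, Pi.add_apply, Prod.fst_add, Prod.snd_add,
      smul_eq_mul, Int.cast_add, mul_add, Finset.sum_add_distrib]
    ring

/-- The complex torus `ℂⁿ / 2π(ℤⁿ ⊕ Tℤⁿ)`, with the quotient topology. -/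
abbrev ComplexTorus {n : ℕ} (T : Matrix (Fin n) (Fin n) ℂ) : Type :=
  (Fin n → ℂ) ⧸ (period T).range

/-- The projection `ℂⁿ → ℂⁿ / 2π(ℤⁿ ⊕ Tℤⁿ)`. -/
noncomputable def ComplexTorus.mk {n : ℕ} (T : Matrix (Fin n) (Fin n) ℂ) (z : Fin n → ℂ) : ComplexTorus T :=
  QuotientAddGroup.mk z

/-- The real coordinate `y` in `z = x + T y`, i.e. `y = (Im T)⁻¹ Im z`. -/
noncomputable def coordY {n : ℕ} (T : Matrix (Fin n) (Fin n) ℂ) :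
    (Fin n → ℂ) →ₗ[ℝ] (Fin n → ℝ) :=
  (T.map Complex.im)⁻¹.mulVecLin ∘ₗ Complex.imLm.compLeft (Fin n)

/-- The real coordinate `x` in `z = x + T y`, i.e. `x = Re z - (Re T) y`. -/
noncomputable def coordX {n : ℕ} (T : Matrix (Fin n) (Fin n) ℂ) :
    (Fin n → ℂ) →ₗ[ℝ] (Fin n → ℝ) :=
  Complex.reLm.compLeft (Fin n) - (T.map Complex.re).mulVecLin ∘ₗ coordY T

theorem im_mulVec_ofReal {n : ℕ} (T : Matrix (Fin n) (Fin n) ℂ) (v : Fin n → ℝ) (i : Fin n) :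
    ((T *ᵥ fun j => (v j : ℂ)) i).im = (T.map Complex.im *ᵥ v) i := by
  simp [Matrix.mulVec, dotProduct]

theorem re_mulVec_ofReal {n : ℕ} (T : Matrix (Fin n) (Fin n) ℂ) (v : Fin n → ℝ) (i : Fin n) :
    ((T *ᵥ fun j => (v j : ℂ)) i).re = (T.map Complex.re *ᵥ v) i := by
  simp [Matrix.mulVec, dotProduct]

theorem coordY_eq {n : ℕ} (T : Matrix (Fin n) (Fin n) ℂ) (hT : (T.map Complex.im).det ≠ 0)
    (x y : Fin n → ℝ) :
    coordY T ((fun i => (x i : ℂ)) + T *ᵥ fun i => (y i : ℂ)) = y := by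
  have h : (Complex.imLm.compLeft (Fin n))
      ((fun i => (x i : ℂ)) + T *ᵥ fun i => (y i : ℂ)) = T.map Complex.im *ᵥ y := by
    funext i
    simp [im_mulVec_ofReal]
  simp only [coordY, LinearMap.comp_apply, h, Matrix.mulVecLin_apply, Matrix.mulVec_mulVec]
  rw [Matrix.nonsing_inv_mul _ (isUnit_iff_ne_zero.mpr hT), Matrix.one_mulVec]

theorem coordX_eq {n : ℕ} (T : Matrix (Fin n) (Fin n) ℂ) (hT : (T.map Complex.im).det ≠ 0)
    (x y : Fin n → ℝ) :
    coordX T ((fun i => (x i : ℂ)) + T *ᵥ fun i => (y i : ℂ)) = x := by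
  funext i
  simp [coordX, coordY_eq T hT, re_mulVec_ofReal]

theorem period_eq {n : ℕ} (T : Matrix (Fin n) (Fin n) ℂ) (l : (Fin n → ℤ) × (Fin n → ℤ)) :
    period T l = (fun i => (((2 * Real.pi * l.1 i : ℝ)) : ℂ)) +
      T *ᵥ fun i => ((2 * Real.pi * l.2 i : ℝ) : ℂ) := by
  have h : (fun i => ((2 * Real.pi * l.2 i : ℝ) : ℂ)) =
      (2 * Real.pi : ℂ) • (fun i => (l.2 i : ℂ)) := by
    funext i; simp
  rw [h, Matrix.mulVec_smul]
  funext i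
  simp [period]

theorem coordY_period {n : ℕ} (T : Matrix (Fin n) (Fin n) ℂ) (hT : (T.map Complex.im).det ≠ 0)
    (l : (Fin n → ℤ) × (Fin n → ℤ)) (i : Fin n) :
    coordY T (period T l) i = 2 * Real.pi * l.2 i := by
  rw [period_eq, coordY_eq T hT]

theorem coordX_period {n : ℕ} (T : Matrix (Fin n) (Fin n) ℂ) (hT : (T.map Complex.im).det ≠ 0)
    (l : (Fin n → ℤ) × (Fin n → ℤ)) (i : Fin n) :
    coordX T (period T l) i = 2 * Real.pi * l.1 i := by
  rw [period_eq, coordX_eq T hT]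

/-! ### Smooth complex vector bundles on complex tori -/

/-- A smooth complex vector bundle of rank `N` on `ℂⁿ / 2π(ℤⁿ ⊕ Tℤⁿ)` (for `Im T` invertible),
given by its transition functions (a smooth factor of automorphy). It is the quotient of
`ℂⁿ × ℂᴺ` by the lattice action `(z, v) ↦ (z + period T l, factor l z *ᵥ v)`; a section over `U`
is a function `s` on the preimage of `U` in `ℂⁿ` with `s (z + period T l) = factor l z *ᵥ s z`. -/
structure TorusBundle {n : ℕ} (T : Matrix (Fin n) (Fin n) ℂ) (N : ℕ) where
  factor : (Fin n → ℤ) × (Fin n → ℤ) → (Fin n → ℂ) → Matrix (Fin N) (Fin N) ℂ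
  smooth : ∀ l i j, ContDiff ℝ ∞ fun z => factor l z i j
  factor_zero : ∀ z, factor 0 z = 1
  cocycle : ∀ l l' z, factor (l + l') z = factor l (z + period T l') * factor l' z

/-- A connection `d + form` on a bundle: a smooth matrix-valued real 1-form on `ℂⁿ`, compatible
with the transition functions of the bundle. -/
structure TorusBundle.Connection {n N : ℕ} {T : Matrix (Fin n) (Fin n) ℂ}
    (E : TorusBundle T N) where
  form : (Fin n → ℂ) → (Fin n → ℂ) →ₗ[ℝ] Matrix (Fin N) (Fin N) ℂ
  smooth : ∀ v i j, ContDiff ℝ ∞ fun z => form z v i j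
  compat : ∀ l z v,
    (Matrix.of fun i j => fderiv ℝ (fun w => E.factor l w i j) z v) +
      form (z + period T l) v * E.factor l z = E.factor l z * form z v

/-- `s` represents a smooth section of `E` over the open set `U`. -/
structure TorusBundle.IsSmoothSection {n N : ℕ} {T : Matrix (Fin n) (Fin n) ℂ}
    (E : TorusBundle T N) (U : Set (ComplexTorus T)) (s : (Fin n → ℂ) → (Fin N → ℂ)) : Prop where
  smooth : ContDiffOn ℝ ∞ s (ComplexTorus.mk T ⁻¹' U)
  equivariant : ∀ l, ∀ z ∈ ComplexTorus.mk T ⁻¹' U, s (z + period T l) = E.factor l z *ᵥ s z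

/-- A smooth local frame (equivalently, a smooth local trivialization) of `E` over an open set of
the torus. -/
structure TorusBundle.LocalFrame {n N : ℕ} {T : Matrix (Fin n) (Fin n) ℂ}
    (E : TorusBundle T N) where
  base : Set (ComplexTorus T)
  isOpen_base : IsOpen base
  sec : Fin N → (Fin n → ℂ) → (Fin N → ℂ)
  isSmoothSection : ∀ j, E.IsSmoothSection base (sec j)
  linearIndependent : ∀ z ∈ ComplexTorus.mk T ⁻¹' base, LinearIndependent ℂ fun j => sec j z

/-- A holomorphic structure on the smooth complex vector bundle `E`: an atlas of smooth local
frames, covering the torus, whose transition matrices are holomorphic. -/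
structure TorusBundle.HolomorphicStructure {n N : ℕ} {T : Matrix (Fin n) (Fin n) ℂ}
    (E : TorusBundle T N) where
  frames : Set E.LocalFrame
  cover : ∀ x : ComplexTorus T, ∃ f ∈ frames, x ∈ f.base
  holomorphic : ∀ f ∈ frames, ∀ f' ∈ frames,
    ∃ h : (Fin n → ℂ) → Matrix (Fin N) (Fin N) ℂ,
      (∀ i j, DifferentiableOn ℂ (fun z => h z i j) (ComplexTorus.mk T ⁻¹' (f.base ∩ f'.base))) ∧
      ∀ z ∈ ComplexTorus.mk T ⁻¹' (f.base ∩ f'.base), ∀ j,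
        f'.sec j z = ∑ i, h z i j • f.sec i z

/-- The covariant derivative `∇_v s = ds(v) + form(v) s`. -/
noncomputable def TorusBundle.Connection.deriv {n N : ℕ} {T : Matrix (Fin n) (Fin n) ℂ}
    {E : TorusBundle T N} (D : E.Connection) (s : (Fin n → ℂ) → (Fin N → ℂ))
    (z v : Fin n → ℂ) : Fin N → ℂ :=
  fderiv ℝ s z v + D.form z v *ᵥ s z

/-- The `(0,1)`-part `∇^{0,1}_v s = (∇_v s + i ∇_{iv} s) / 2` of the covariant derivative. -/
noncomputable def TorusBundle.Connection.derivBar {n N : ℕ} {T : Matrix (Fin n) (Fin n) ℂ}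
    {E : TorusBundle T N} (D : E.Connection) (s : (Fin n → ℂ) → (Fin N → ℂ))
    (z v : Fin n → ℂ) : Fin N → ℂ :=
  (1 / 2 : ℂ) • (D.deriv s z v + Complex.I • D.deriv s z (Complex.I • v))

/-- The smooth complex vector bundle `E` admits a holomorphic structure. -/
def TorusBundle.AdmitsHolomorphicStructure {n N : ℕ} {T : Matrix (Fin n) (Fin n) ℂ}
    (E : TorusBundle T N) : Prop :=
  Nonempty E.HolomorphicStructure

/-- `(E, ∇)` is a holomorphic vector bundle: `E` has a holomorphic structure whose Dolbeault
operator is `∇^{0,1}`, i.e. `∇^{0,1}` kills its holomorphic local frames. -/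
def TorusBundle.Connection.IsHolomorphic {n N : ℕ} {T : Matrix (Fin n) (Fin n) ℂ}
    {E : TorusBundle T N} (D : E.Connection) : Prop :=
  ∃ H : E.HolomorphicStructure, ∀ f ∈ H.frames, ∀ j,
    ∀ z ∈ ComplexTorus.mk T ⁻¹' f.base, ∀ v, D.derivBar (f.sec j) z v = 0

/-! ### Pullback along a homomorphism of complex tori -/

/-- A holomorphic homomorphism between complex tori: a complex linear map (given by its matrix)
together with the induced map of the lattices. -/
structure TorusHom {n : ℕ} (T T₁ : Matrix (Fin n) (Fin n) ℂ) where
  lin : Matrix (Fin n) (Fin n) ℂ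
  onLattice : ((Fin n → ℤ) × (Fin n → ℤ)) →+ ((Fin n → ℤ) × (Fin n → ℤ))
  compat : ∀ l, lin *ᵥ period T l = period T₁ (onLattice l)

theorem contDiff_matrix_mulVec {n : ℕ} (F : Matrix (Fin n) (Fin n) ℂ) :
    ContDiff ℝ ∞ fun z : Fin n → ℂ => F *ᵥ z :=
  (LinearMap.toContinuousLinearMap (F.mulVecLin.restrictScalars ℝ)).contDiff

theorem hasFDerivAt_matrix_mulVec {n : ℕ} (F : Matrix (Fin n) (Fin n) ℂ) (z : Fin n → ℂ) :
    HasFDerivAt (𝕜 := ℝ) (fun z : Fin n → ℂ => F *ᵥ z)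
      (LinearMap.toContinuousLinearMap (F.mulVecLin.restrictScalars ℝ)) z :=
  (LinearMap.toContinuousLinearMap (F.mulVecLin.restrictScalars ℝ)).hasFDerivAt

/-- The pullback bundle: the fibre over (the class of) `z` is the fibre over `lin z`. -/
def TorusBundle.pullback {n N : ℕ} {T T₁ : Matrix (Fin n) (Fin n) ℂ}
    (E : TorusBundle T₁ N) (φ : TorusHom T T₁) : TorusBundle T N where
  factor l z := E.factor (φ.onLattice l) (φ.lin *ᵥ z)
  smooth l i j := (E.smooth (φ.onLattice l) i j).comp (contDiff_matrix_mulVec φ.lin)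
  factor_zero z := by simp [E.factor_zero]
  cocycle l l' z := by
    rw [map_add, E.cocycle, Matrix.mulVec_add, φ.compat]

/-- The pullback connection `d + φ*form`. -/
noncomputable def TorusBundle.Connection.pullback {n N : ℕ} {T T₁ : Matrix (Fin n) (Fin n) ℂ}
    {E : TorusBundle T₁ N} (D : E.Connection) (φ : TorusHom T T₁) :
    (E.pullback φ).Connection where
  form z := D.form (φ.lin *ᵥ z) ∘ₗ φ.lin.mulVecLin.restrictScalars ℝ
  smooth v i j := (D.smooth (φ.lin *ᵥ v) i j).comp (contDiff_matrix_mulVec φ.lin)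
  compat l z v := by
    have h := D.compat (φ.onLattice l) (φ.lin *ᵥ z) (φ.lin *ᵥ v)
    rw [← φ.compat, ← Matrix.mulVec_add] at h
    refine Eq.trans ?_ h
    congr 1
    ext i j
    have hd : DifferentiableAt ℝ (fun w => E.factor (φ.onLattice l) w i j) (φ.lin *ᵥ z) :=
      ((E.smooth (φ.onLattice l) i j).differentiable (by simp)).differentiableAt
    have hc := hd.hasFDerivAt.comp z (hasFDerivAt_matrix_mulVec φ.lin z)
    simp only [Matrix.of_apply]
    exact congrArg (fun L => L v) hc.fderiv

/-! ### The bundles `E_{(r, A, μ, 𝒰)}` -/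

/-- `N` is the number `r' = ∏ r'_i` attached to `(r, A)`: with `P A Q = diag(d_1, …, d_n)` the
elementary divisor form of `A` (`P, Q ∈ GL(n; ℤ)`, `d_i ∣ d_{i+1}`), `r'_i` is the denominator of
`d_i / r` in lowest terms. The vanishing `d_i` contribute the factor `1`. -/
def IsReducedRank {n : ℕ} (r : ℕ) (A : Matrix (Fin n) (Fin n) ℤ) (N : ℕ) : Prop :=
  ∃ (P Q : GL (Fin n) ℤ) (d : Fin n → ℕ),
    (P : Matrix (Fin n) (Fin n) ℤ) * A * (Q : Matrix (Fin n) (Fin n) ℤ) =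
      Matrix.diagonal (fun i => (d i : ℤ)) ∧
    (∀ i j, i ≤ j → d i ∣ d j) ∧
    N = ∏ i, ((d i : ℚ) / (r : ℚ)).den

/-- The root of unity `ζ = e^{2πi/r}`. -/
noncomputable def rootZeta (r : ℕ) : ℂ := Complex.exp (2 * Real.pi * Complex.I / r)

/-- Unitary matrices `V_j, U_k ∈ U(N)` satisfying the cocycle relations. -/
structure UnitarySystem {n : ℕ} (r : ℕ) (A : Matrix (Fin n) (Fin n) ℤ) (N : ℕ) where
  V : Fin n → Matrix.unitaryGroup (Fin N) ℂ
  U : Fin n → Matrix.unitaryGroup (Fin N) ℂ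
  commV : ∀ j k, V j * V k = V k * V j
  commU : ∀ j k, U j * U k = U k * U j
  commUV : ∀ j k, rootZeta r ^ (-(A k j)) •
    ((U k : Matrix (Fin N) (Fin N) ℂ) * (V j : Matrix (Fin N) (Fin N) ℂ)) =
      (V j : Matrix (Fin N) (Fin N) ℂ) * (U k : Matrix (Fin N) (Fin N) ℂ)

theorem pairwise_commute_zpow {n : ℕ} {G : Type} [Group G] {g : Fin n → G}
    (hg : ∀ i j, g i * g j = g j * g i) (m : Fin n → ℤ) (s : Finset (Fin n)) :
    (s : Set (Fin n)).Pairwise (Function.onFun Commute fun i => g i ^ m i) :=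
  fun i _ j _ _ => Commute.zpow_zpow (hg i j) (m i) (m j)

/-- The product `∏ g_i ^ {m_i}` of powers of commuting group elements. -/
def prodPow {n : ℕ} {G : Type} [Group G] (g : Fin n → G) (hg : ∀ i j, g i * g j = g j * g i)
    (m : Fin n → ℤ) : G :=
  Finset.univ.noncommProd (fun i => g i ^ m i) (pairwise_commute_zpow hg m Finset.univ)

theorem prodPow_zero {n : ℕ} {G : Type} [Group G] (g : Fin n → G)
    (hg : ∀ i j, g i * g j = g j * g i) : prodPow g hg 0 = 1 := by
  have h := Finset.noncommProd_eq_pow_card (Finset.univ : Finset (Fin n))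
    (fun i => g i ^ (0 : Fin n → ℤ) i) (pairwise_commute_zpow hg 0 Finset.univ) 1 (by simp)
  simpa [prodPow] using h

theorem prodPow_add {n : ℕ} {G : Type} [Group G] (g : Fin n → G)
    (hg : ∀ i j, g i * g j = g j * g i) (m m' : Fin n → ℤ) :
    prodPow g hg (m + m') = prodPow g hg m * prodPow g hg m' := by
  unfold prodPow
  rw [← Finset.noncommProd_mul_distrib (fun i => g i ^ m i) (fun i => g i ^ m' i)
    (pairwise_commute_zpow hg m Finset.univ) (pairwise_commute_zpow hg m' Finset.univ)
    (fun i _ j _ _ => Commute.zpow_zpow (hg i j) (m' i) (m j))]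
  refine Finset.noncommProd_congr rfl (fun i _ => ?_) _
  simp [zpow_add]

theorem mul_zpow_of_twist {G : Type} [Group G] {c x y : G} (hc : ∀ g : G, c * g = g * c) {b : ℤ}
    (h : x * y = c ^ b * (y * x)) (m : ℤ) : x * y ^ m = c ^ (b * m) * (y ^ m * x) := by
  have hcb : Commute (c ^ b) y := Commute.zpow_left (hc y) b
  have h1 : x * y * x⁻¹ = c ^ b * y := by rw [h]; group
  have h2 : x * y ^ m * x⁻¹ = c ^ (b * m) * y ^ m := by
    rw [← conj_zpow, h1, hcb.mul_zpow, zpow_mul]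
  rw [← mul_assoc, ← h2]; group

theorem mul_prodPow_of_twist {n : ℕ} {G : Type} [Group G] {g : Fin n → G}
    (hg : ∀ i j, g i * g j = g j * g i) {c x : G} (hc : ∀ g : G, c * g = g * c) {b : Fin n → ℤ}
    (h : ∀ j, x * g j = c ^ b j * (g j * x)) (m : Fin n → ℤ) :
    x * prodPow g hg m = c ^ (∑ j, b j * m j) * (prodPow g hg m * x) := by
  unfold prodPow
  have key : ∀ s : Finset (Fin n),
      x * s.noncommProd (fun i => g i ^ m i) (pairwise_commute_zpow hg m s) =
        c ^ (∑ j ∈ s, b j * m j) *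
          (s.noncommProd (fun i => g i ^ m i) (pairwise_commute_zpow hg m s) * x) := by
    intro s
    induction s using Finset.induction_on with
    | empty => simp
    | insert a s ha ih =>
      rw [Finset.noncommProd_insert_of_notMem _ _ _ _ ha, Finset.sum_insert ha, zpow_add,
        ← mul_assoc, mul_zpow_of_twist hc (h a)]
      have hcc : c ^ (∑ j ∈ s, b j * m j) * g a ^ m a = g a ^ m a * c ^ (∑ j ∈ s, b j * m j) :=
        Commute.zpow_left (hc _) _
      simp only [mul_assoc]
      rw [ih, ← mul_assoc (g a ^ m a), ← hcc]
      simp only [mul_assoc]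
  exact key Finset.univ

theorem prodPow_mul_prodPow_of_twist {n : ℕ} {G : Type} [Group G] {u v : Fin n → G}
    (hu : ∀ i j, u i * u j = u j * u i) (hv : ∀ i j, v i * v j = v j * v i) {c : G}
    (hc : ∀ g : G, c * g = g * c) {a : Fin n → Fin n → ℤ}
    (h : ∀ k j, u k * v j = c ^ a k j * (v j * u k)) (k m : Fin n → ℤ) :
    prodPow u hu k * prodPow v hv m =
      c ^ (∑ i, ∑ j, k i * a i j * m j) * (prodPow v hv m * prodPow u hu k) := by
  have h1 : ∀ i, prodPow v hv m * u i =
      c ^ (-∑ j, a i j * m j) * (u i * prodPow v hv m) := by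
    intro i
    rw [mul_prodPow_of_twist hv hc (h i) m, ← mul_assoc, ← zpow_add]
    simp
  have h2 := mul_prodPow_of_twist hu hc h1 k
  rw [h2, ← mul_assoc, ← zpow_add, ← Finset.sum_add_distrib]
  have h3 : ∑ i, (∑ j, k i * a i j * m j + (-∑ j, a i j * m j) * k i) = 0 := by
    refine Finset.sum_eq_zero fun i _ => ?_
    rw [neg_mul, Finset.sum_mul, ← sub_eq_add_neg, sub_eq_zero]
    exact Finset.sum_congr rfl fun j _ => by ring
  rw [h3]; simp

/-- The unitary matrix `V^m = ∏ V_j ^ {m_j}`. -/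
noncomputable def UnitarySystem.VPow {n r N : ℕ} {A : Matrix (Fin n) (Fin n) ℤ}
    (S : UnitarySystem r A N) (m : Fin n → ℤ) : Matrix (Fin N) (Fin N) ℂ :=
  (prodPow S.V S.commV m : Matrix.unitaryGroup (Fin N) ℂ)

/-- The unitary matrix `U^k = ∏ U_j ^ {k_j}`. -/
noncomputable def UnitarySystem.UPow {n r N : ℕ} {A : Matrix (Fin n) (Fin n) ℤ}
    (S : UnitarySystem r A N) (k : Fin n → ℤ) : Matrix (Fin N) (Fin N) ℂ :=
  (prodPow S.U S.commU k : Matrix.unitaryGroup (Fin N) ℂ)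

theorem rootZeta_ne_zero (r : ℕ) : rootZeta r ≠ 0 := Complex.exp_ne_zero _

theorem star_rootZeta_mul (r : ℕ) : star (rootZeta r) * rootZeta r = 1 := by
  have h : star (rootZeta r) = Complex.exp (-(2 * Real.pi * Complex.I / r)) := by
    simp only [rootZeta, Complex.star_def, ← Complex.exp_conj]
    congr 1
    have h2 : (starRingEnd ℂ) 2 = 2 := Complex.conj_ofNat 2
    simp [neg_div, h2]
  rw [h, rootZeta, ← Complex.exp_add]
  simp

/-- `ζ` as a central unitary matrix. -/
noncomputable def zetaUnitary (r N : ℕ) : Matrix.unitaryGroup (Fin N) ℂ :=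
  ⟨rootZeta r • 1, by
    rw [Matrix.mem_unitaryGroup_iff']
    rw [star_smul, star_one, smul_mul_smul_comm, star_rootZeta_mul, one_mul, one_smul]⟩

theorem zetaUnitary_central (r N : ℕ) (g : Matrix.unitaryGroup (Fin N) ℂ) :
    zetaUnitary r N * g = g * zetaUnitary r N := by
  apply Subtype.ext
  simp [zetaUnitary]

theorem zetaUnitary_zpow (r N : ℕ) (a : ℤ) :
    ((zetaUnitary r N ^ a : Matrix.unitaryGroup (Fin N) ℂ) : Matrix (Fin N) (Fin N) ℂ) =
      rootZeta r ^ a • 1 := by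
  have hnat : ∀ k : ℕ, ((zetaUnitary r N ^ k : Matrix.unitaryGroup (Fin N) ℂ) :
      Matrix (Fin N) (Fin N) ℂ) = rootZeta r ^ k • 1 := by
    intro k
    rw [SubmonoidClass.coe_pow]
    simp [zetaUnitary, smul_pow]
  have hinv : star (rootZeta r) = (rootZeta r)⁻¹ := eq_inv_of_mul_eq_one_left (star_rootZeta_mul r)
  obtain ⟨k, rfl | rfl⟩ := a.eq_nat_or_neg
  · simpa using hnat k
  · rw [zpow_neg, zpow_natCast, ← Unitary.star_eq_inv, Unitary.coe_star, hnat k, star_smul,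
      star_one, star_pow, hinv, zpow_neg, zpow_natCast, inv_pow]

theorem UnitarySystem.UPow_mul_VPow {n r N : ℕ} {A : Matrix (Fin n) (Fin n) ℤ}
    (S : UnitarySystem r A N) (k m : Fin n → ℤ) :
    S.UPow k * S.VPow m =
      rootZeta r ^ (∑ i, ∑ j, k i * A i j * m j) • (S.VPow m * S.UPow k) := by
  have h : ∀ k j, S.U k * S.V j = zetaUnitary r N ^ A k j * (S.V j * S.U k) := by
    intro k j
    apply Subtype.ext
    rw [Submonoid.coe_mul, Submonoid.coe_mul, Submonoid.coe_mul, zetaUnitary_zpow,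
      ← S.commUV j k, smul_mul_smul_comm, one_mul, ← zpow_add₀ (rootZeta_ne_zero r)]
    simp
  have h2 := congrArg (Subtype.val)
    (prodPow_mul_prodPow_of_twist S.commU S.commV (zetaUnitary_central r N) h k m)
  rw [Submonoid.coe_mul, Submonoid.coe_mul, Submonoid.coe_mul, zetaUnitary_zpow, smul_mul_assoc,
    one_mul] at h2
  exact h2

theorem UnitarySystem.VPow_add {n r N : ℕ} {A : Matrix (Fin n) (Fin n) ℤ}
    (S : UnitarySystem r A N) (m m' : Fin n → ℤ) : S.VPow (m + m') = S.VPow m * S.VPow m' := by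
  simp [UnitarySystem.VPow, prodPow_add]

theorem UnitarySystem.UPow_add {n r N : ℕ} {A : Matrix (Fin n) (Fin n) ℤ}
    (S : UnitarySystem r A N) (k k' : Fin n → ℤ) : S.UPow (k + k') = S.UPow k * S.UPow k' := by
  simp [UnitarySystem.UPow, prodPow_add]

/-- The real-linear function `z ↦ ∑_j m_j a_j y`, where `a_j = (a_{1j}, …, a_{nj})` and
`z = x + T y`. -/
noncomputable def linPhase {n : ℕ} (T : Matrix (Fin n) (Fin n) ℂ) (A : Matrix (Fin n) (Fin n) ℤ)
    (m : Fin n → ℤ) : (Fin n → ℂ) →ₗ[ℝ] ℝ :=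
  ∑ j, (m j : ℝ) • ∑ i, (A i j : ℝ) • (LinearMap.proj i ∘ₗ coordY T)

theorem linPhase_apply {n : ℕ} (T : Matrix (Fin n) (Fin n) ℂ) (A : Matrix (Fin n) (Fin n) ℤ)
    (m : Fin n → ℤ) (z : Fin n → ℂ) :
    linPhase T A m z = ∑ j, (m j : ℝ) * ∑ i, (A i j : ℝ) * coordY T z i := by
  simp [linPhase]

theorem linPhase_add {n : ℕ} (T : Matrix (Fin n) (Fin n) ℂ) (A : Matrix (Fin n) (Fin n) ℤ)
    (m m' : Fin n → ℤ) (z : Fin n → ℂ) :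
    linPhase T A (m + m') z = linPhase T A m z + linPhase T A m' z := by
  simp [linPhase_apply, add_mul, Finset.sum_add_distrib]

theorem linPhase_period {n : ℕ} (T : Matrix (Fin n) (Fin n) ℂ) (hT : (T.map Complex.im).det ≠ 0)
    (A : Matrix (Fin n) (Fin n) ℤ) (m : Fin n → ℤ) (l : (Fin n → ℤ) × (Fin n → ℤ)) :
    linPhase T A m (period T l) =
      2 * Real.pi * ((∑ i, ∑ j, l.2 i * A i j * m j : ℤ) : ℝ) := by
  simp only [linPhase_apply, coordY_period T hT]
  push_cast
  rw [Finset.sum_comm, Finset.mul_sum]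
  refine Finset.sum_congr rfl fun j _ => ?_
  rw [Finset.mul_sum, Finset.mul_sum]
  exact Finset.sum_congr rfl fun i _ => by ring

theorem exp_linPhase_period {n : ℕ} (T : Matrix (Fin n) (Fin n) ℂ)
    (hT : (T.map Complex.im).det ≠ 0) (r : ℕ) (A : Matrix (Fin n) (Fin n) ℤ) (m : Fin n → ℤ)
    (l : (Fin n → ℤ) × (Fin n → ℤ)) :
    Complex.exp (Complex.I / r * (linPhase T A m (period T l) : ℝ)) =
      rootZeta r ^ (∑ i, ∑ j, l.2 i * A i j * m j) := by
  rw [linPhase_period T hT, rootZeta, ← Complex.exp_int_mul]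
  congr 1
  push_cast
  ring

theorem contDiff_exp_linPhase {n : ℕ} (T : Matrix (Fin n) (Fin n) ℂ) (r : ℕ)
    (A : Matrix (Fin n) (Fin n) ℤ) (m : Fin n → ℤ) (c : ℝ) :
    ContDiff ℝ ∞ fun z : Fin n → ℂ => Complex.exp (Complex.I / r * ((linPhase T A m z + c : ℝ))) := by
  have h1 : ContDiff ℝ ∞ fun z : Fin n → ℂ => linPhase T A m z :=
    (LinearMap.toContinuousLinearMap (linPhase T A m)).contDiff
  exact (contDiff_const.mul (Complex.ofRealCLM.contDiff.comp (h1.add contDiff_const))).cexp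

theorem fderiv_exp_linPhase {n : ℕ} (T : Matrix (Fin n) (Fin n) ℂ) (r : ℕ)
    (A : Matrix (Fin n) (Fin n) ℤ) (m : Fin n → ℤ) (c : ℝ) (b : ℂ) (z v : Fin n → ℂ) :
    fderiv ℝ (fun w : Fin n → ℂ => Complex.exp (Complex.I / r * ((linPhase T A m w + c : ℝ))) * b)
      z v = Complex.exp (Complex.I / r * ((linPhase T A m z + c : ℝ))) *
        (Complex.I / r * (linPhase T A m v : ℝ)) * b := by
  have h1 : HasFDerivAt (fun w : Fin n → ℂ => linPhase T A m w)
      (LinearMap.toContinuousLinearMap (linPhase T A m)) z :=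
    (LinearMap.toContinuousLinearMap (linPhase T A m)).hasFDerivAt
  have h2 := ((Complex.ofRealCLM.hasFDerivAt.comp z (h1.add_const c)).const_mul
    (Complex.I / r)).cexp.mul_const b
  refine (congrArg (fun L => L v) h2.fderiv).trans ?_
  simp
  ring

/-- The complex vector bundle `E_{(r, A, 𝒰)}` of rank `N` on `ℂⁿ / 2π(ℤⁿ ⊕ Tℤⁿ)`. Its sections
satisfy `s(…, x_j + 2π, …) = e^{(i/r) a_j y} V_j s` and `s(…, y_k + 2π, …) = U_k s` in the
coordinates `z = x + T y`; hence, translating first by `2π T k` and then by `2π m`,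
`s(z + 2π (m + T k)) = e^{(i/r) ∑_j m_j a_j (y + 2π k)} V^m U^k s(z)`. -/
noncomputable def bundleE {n r N : ℕ} (T : Matrix (Fin n) (Fin n) ℂ)
    (hT : (T.map Complex.im).det ≠ 0) (A : Matrix (Fin n) (Fin n) ℤ) (S : UnitarySystem r A N) :
    TorusBundle T N where
  factor l z := Complex.exp (Complex.I / r * (linPhase T A l.1 (z + period T l) : ℝ)) •
    (S.VPow l.1 * S.UPow l.2)
  smooth l i j := by
    have h := contDiff_exp_linPhase T r A l.1 (linPhase T A l.1 (period T l))
    simp only [map_add, Matrix.smul_apply, smul_eq_mul]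
    exact h.mul contDiff_const
  factor_zero z := by
    have h : linPhase T A 0 z = 0 := by simp [linPhase_apply]
    simp [h, UnitarySystem.VPow, UnitarySystem.UPow, prodPow_zero]
  cocycle l l' z := by
    have h : S.VPow (l.1 + l'.1) * S.UPow (l.2 + l'.2) =
        rootZeta r ^ (-(∑ i, ∑ j, l.2 i * A i j * l'.1 j)) •
          ((S.VPow l.1 * S.UPow l.2) * (S.VPow l'.1 * S.UPow l'.2)) := by
      have h' : (S.VPow l.1 * S.UPow l.2) * (S.VPow l'.1 * S.UPow l'.2) =
          S.VPow l.1 * (S.UPow l.2 * S.VPow l'.1) * S.UPow l'.2 := by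
        simp only [mul_assoc]
      rw [h', S.UPow_mul_VPow, S.VPow_add, S.UPow_add, mul_smul_comm, smul_mul_assoc, smul_smul,
        ← zpow_add₀ (rootZeta_ne_zero r)]
      simp [mul_assoc]
    rw [Prod.fst_add, Prod.snd_add, h, smul_smul, smul_mul_smul_comm, zpow_neg,
      ← exp_linPhase_period T hT, ← Complex.exp_neg, ← Complex.exp_add, ← Complex.exp_add]
    congr 2
    simp only [map_add, linPhase_add]
    push_cast
    ring

/-- The connection
`∇_{(r, A, μ, 𝒰)} = d - (i / 2π) ((1/r) xᵗ Aᵗ + (1/r) μᵗ) dy · I_N` on `E_{(r, A, 𝒰)}`. -/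
noncomputable def connectionE {n r N : ℕ} (T : Matrix (Fin n) (Fin n) ℂ)
    (hT : (T.map Complex.im).det ≠ 0) (A : Matrix (Fin n) (Fin n) ℤ) (S : UnitarySystem r A N)
    (μ : Fin n → ℂ) : (bundleE T hT A S).Connection where
  form z :=
    { toFun := fun v => (-(Complex.I / (2 * Real.pi)) *
        ∑ i, ((1 / r : ℂ) * ∑ j, (coordX T z j : ℂ) * (A i j : ℂ) + (1 / r : ℂ) * μ i) *
          (coordY T v i : ℂ)) • 1
      map_add' := fun v w => by
        simp only [map_add, Pi.add_apply, Complex.ofReal_add, mul_add, Finset.sum_add_distrib,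
          add_smul]
      map_smul' := fun c v => by
        ext a b
        simp only [map_smul, Pi.smul_apply, smul_eq_mul, Complex.ofReal_mul, Matrix.smul_apply,
          RingHom.id_apply, Complex.real_smul, Finset.mul_sum, Finset.sum_mul]
        exact Finset.sum_congr rfl fun i _ => by ring }
  smooth v a b := by
    have hX : ∀ j, ContDiff ℝ ∞ fun z : Fin n → ℂ => ((coordX T z j : ℝ) : ℂ) := fun j =>
      Complex.ofRealCLM.contDiff.comp
        (LinearMap.toContinuousLinearMap (LinearMap.proj j ∘ₗ coordX T)).contDiff
    simp only [LinearMap.coe_mk, AddHom.coe_mk, Matrix.smul_apply, smul_eq_mul]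
    refine ContDiff.mul (contDiff_const.mul (ContDiff.sum fun i _ => ?_)) contDiff_const
    refine ContDiff.mul (ContDiff.add (contDiff_const.mul (ContDiff.sum fun j _ => ?_))
      contDiff_const) contDiff_const
    exact (hX j).mul contDiff_const
  compat l z v := by
    have hpi : (Real.pi : ℂ) ≠ 0 := by exact_mod_cast Real.pi_ne_zero
    have hshift : -(Complex.I / (2 * Real.pi)) *
        ∑ i, ((1 / r : ℂ) * ∑ j, (coordX T (z + period T l) j : ℂ) * (A i j : ℂ) +
          (1 / r : ℂ) * μ i) * (coordY T v i : ℂ) =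
        -(Complex.I / (2 * Real.pi)) *
        ∑ i, ((1 / r : ℂ) * ∑ j, (coordX T z j : ℂ) * (A i j : ℂ) +
          (1 / r : ℂ) * μ i) * (coordY T v i : ℂ) -
        Complex.I / r * (linPhase T A l.1 v : ℝ) := by
      have h1 : ((linPhase T A l.1 v : ℝ) : ℂ) =
          ∑ i, (∑ j, (l.1 j : ℂ) * (A i j : ℂ)) * (coordY T v i : ℂ) := by
        rw [linPhase_apply]
        push_cast
        simp only [Finset.mul_sum, Finset.sum_mul]
        rw [Finset.sum_comm]
        exact Finset.sum_congr rfl fun i _ => Finset.sum_congr rfl fun j _ => by ring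
      rw [h1, Finset.mul_sum, Finset.mul_sum, Finset.mul_sum, ← Finset.sum_sub_distrib]
      refine Finset.sum_congr rfl fun i _ => ?_
      have h2 : ∑ j, (coordX T (z + period T l) j : ℂ) * (A i j : ℂ) =
          ∑ j, (coordX T z j : ℂ) * (A i j : ℂ) +
            2 * Real.pi * ∑ j, (l.1 j : ℂ) * (A i j : ℂ) := by
        rw [Finset.mul_sum, ← Finset.sum_add_distrib]
        refine Finset.sum_congr rfl fun j _ => ?_
        rw [map_add, Pi.add_apply, coordX_period T hT]
        push_cast
        ring
      rw [h2]
      field_simp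
      ring
    simp only [LinearMap.coe_mk, AddHom.coe_mk]
    rw [hshift]
    ext a b
    simp only [bundleE, map_add, Matrix.add_apply, Matrix.of_apply, Matrix.smul_apply, smul_eq_mul,
      smul_mul_assoc, mul_smul_comm, one_mul, mul_one]
    rw [fderiv_exp_linPhase]
    ring

/-! ### The biholomorphic map `φ` -/

/-- The matrix `T' = (-T + δ)⁻¹`. -/
noncomputable def dualPeriod {n : ℕ} (T : Matrix (Fin n) (Fin n) ℂ)
    (δ : Matrix (Fin n) (Fin n) ℤ) : Matrix (Fin n) (Fin n) ℂ :=
  (-T + δ.map (Int.cast : ℤ → ℂ))⁻¹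

theorem isUnit_det_neg_add {n : ℕ} {T : Matrix (Fin n) (Fin n) ℂ} {δ : Matrix (Fin n) (Fin n) ℤ}
    (hδ : (T - δ.map (Int.cast : ℤ → ℂ)).det ≠ 0) :
    IsUnit (-T + δ.map (Int.cast : ℤ → ℂ)).det := by
  rw [show -T + δ.map (Int.cast : ℤ → ℂ) = -(T - δ.map (Int.cast : ℤ → ℂ)) by abel,
    Matrix.det_neg]
  exact isUnit_iff_ne_zero.mpr (mul_ne_zero (by simp) hδ)

theorem dualPeriod_im_det_ne_zero {n : ℕ} {T : Matrix (Fin n) (Fin n) ℂ} (hT : ImPosDef T)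
    {δ : Matrix (Fin n) (Fin n) ℤ} (hδ : (T - δ.map (Int.cast : ℤ → ℂ)).det ≠ 0) :
    ((dualPeriod T δ).map Complex.im).det ≠ 0 := by
  intro h0
  obtain ⟨v, hv, hv0⟩ := Matrix.exists_mulVec_eq_zero_iff.mpr h0
  set w : Fin n → ℝ := (dualPeriod T δ).map Complex.re *ᵥ v with hw
  have h1 : dualPeriod T δ *ᵥ (fun j => (v j : ℂ)) = fun j => (w j : ℂ) := by
    funext i
    apply Complex.ext
    · rw [re_mulVec_ofReal]; simp [hw]
    · rw [im_mulVec_ofReal, hv0]; simp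
  have h2 : (-T + δ.map (Int.cast : ℤ → ℂ)) *ᵥ (fun j => (w j : ℂ)) = fun j => (v j : ℂ) := by
    rw [← h1, Matrix.mulVec_mulVec, dualPeriod, Matrix.mul_nonsing_inv _ (isUnit_det_neg_add hδ),
      Matrix.one_mulVec]
  have h3 : T.map Complex.im *ᵥ w = 0 := by
    funext i
    have h4 := congrArg Complex.im (congrFun h2 i)
    rw [im_mulVec_ofReal] at h4
    have h5 : (-T + δ.map (Int.cast : ℤ → ℂ)).map Complex.im = -T.map Complex.im := by
      ext a b; simp
    rw [h5, Matrix.neg_mulVec] at h4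
    simpa using h4
  have hw0 : w = 0 := by
    by_contra hne
    have h6 := hT w hne
    rw [h3] at h6
    simp at h6
  apply hv
  funext i
  have h7 := congrFun h2 i
  rw [hw0] at h7
  have h8 : (fun j => (((0 : Fin n → ℝ) j : ℝ) : ℂ)) = 0 := by funext j; simp
  rw [h8, Matrix.mulVec_zero] at h7
  simpa using h7.symm

/-- The biholomorphic map `φ(z) = (-T + δ)⁻¹ z` from `ℂⁿ / 2π(ℤⁿ ⊕ Tℤⁿ)` to
`ℂⁿ / 2π(ℤⁿ ⊕ T'ℤⁿ)`; in the real coordinates it is `(x, y) ↦ (-y, x + δ y)`. -/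
noncomputable def phi {n : ℕ} (T : Matrix (Fin n) (Fin n) ℂ) (δ : Matrix (Fin n) (Fin n) ℤ)
    (hδ : (T - δ.map (Int.cast : ℤ → ℂ)).det ≠ 0) : TorusHom T (dualPeriod T δ) where
  lin := dualPeriod T δ
  onLattice :=
    { toFun := fun l => (-l.2, l.1 + δ *ᵥ l.2)
      map_zero' := by simp
      map_add' := fun a b => by
        ext i
        · simp; ring
        · simp [Matrix.mulVec_add]; ring }
  compat l := by
    have hu := isUnit_det_neg_add hδ
    have h1 : dualPeriod T δ * T = dualPeriod T δ * δ.map (Int.cast : ℤ → ℂ) - 1 := by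
      rw [← Matrix.nonsing_inv_mul _ hu, dualPeriod, ← mul_sub]
      congr 1
      abel
    have h2 : (fun i => (((l.1 + δ *ᵥ l.2) i : ℤ) : ℂ)) =
        (fun i => (l.1 i : ℂ)) + δ.map (Int.cast : ℤ → ℂ) *ᵥ fun i => (l.2 i : ℂ) := by
      funext i
      simp [Matrix.mulVec, dotProduct]
    have h3 : (fun i => (((-l.2) i : ℤ) : ℂ)) = -fun i => (l.2 i : ℂ) := by
      funext i
      simp
    simp only [period, AddMonoidHom.coe_mk, ZeroHom.coe_mk]
    rw [h2, h3, Matrix.mulVec_smul, Matrix.mulVec_add, Matrix.mulVec_mulVec, h1,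
      Matrix.mulVec_add, Matrix.mulVec_mulVec, Matrix.sub_mulVec, Matrix.one_mulVec]
    congr 1
    abel

/-! The connection form is a scalar form `θ` times the identity, affine in the base point, so its
curvature is a constant scalar 2-form proportional to `dXᵗ Aᵗ ∧ dY`. On the source torus `X + T'Y`
is a holomorphic function of `z`, so the antilinear part of `dX` is `-T'` times that of `dY`. The
`(0,2)`-part of the curvature is therefore the antisymmetrization of `A T'` in the antilinear parts
of the `dY_i`. These are linearly independent, so it vanishes exactly when `A T'` is symmetric.

Sense 1 implies sense 2 by forgetting the connection. Sense 2 implies symmetry by an argument on the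
determinant line bundle, which is a bare-hands version of the vanishing of the `(0,2)`-part of the
first Chern class. For a holomorphic frame with matrix `M`, the form `β = N θ^{0,1} + ∂̄ log det M`
does not depend on the frame (`HolomorphicStructure.dlogDet_eq`) and is periodic
(`dlogDet_add_period`). Since `∂̄ ∂̄ log = 0`, `∂̄ β` is `N` times the constant `(0,2)`-curvature.
Derivatives of periodic functions have mean zero over a period cell
(`integral_fderiv_eq_zero_of_periodic`), so this constant is zero.

Symmetry implies sense 1 without any general integrability theorem. If `A T'` is symmetric,
`-θ^{0,1}` has an explicit quadratic `∂̄`-primitive `ψ` (`IsCoordSystem.dbar_primitive`). The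
sections `e^ψ e_j` over a small cell, extended equivariantly, are killed by `∇^{0,1}`
(`derivBar_extendSec`). Two frames killed by the same `∇^{0,1}` differ by a holomorphic matrix
(`differentiableOn_transition`), so all such frames form the required atlas. -/

/-! ### Integrals of derivatives of periodic functions -/

/-- The linear map `x ↦ ∑ x_i P_i`. -/
noncomputable def combMap {ι E : Type*} [Fintype ι] [NormedAddCommGroup E] [NormedSpace ℝ E]
    (P : ι → E) : (ι → ℝ) →L[ℝ] E :=
  ∑ i, (ContinuousLinearMap.proj (R := ℝ) (φ := fun _ : ι => ℝ) i).smulRight (P i)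

theorem combMap_apply {ι E : Type*} [Fintype ι] [NormedAddCommGroup E] [NormedSpace ℝ E]
    (P : ι → E) (x : ι → ℝ) : combMap P x = ∑ i, x i • P i := by
  simp [combMap]

theorem combMap_single {ι E : Type*} [Fintype ι] [DecidableEq ι] [NormedAddCommGroup E]
    [NormedSpace ℝ E] (P : ι → E) (i : ι) : combMap P (Pi.single i 1) = P i := by
  simp [combMap_apply, Pi.single_apply]

theorem continuous_fderiv_combMap {ι E : Type*} [Fintype ι] [NormedAddCommGroup E]
    [NormedSpace ℝ E] (P : ι → E) {f : E → ℂ} (hf : ContDiff ℝ 1 f) (w : E) :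
    Continuous fun x => fderiv ℝ f (combMap P x) w :=
  ((hf.continuous_fderiv one_ne_zero).comp (combMap P).continuous).clm_apply continuous_const

/-- The directional derivatives of a `C¹` function have mean value zero over a period cell. -/
theorem integral_fderiv_eq_zero_of_periodic {m : ℕ} {E : Type*} [NormedAddCommGroup E]
    [NormedSpace ℝ E] (P : Fin (m + 1) → E) {f : E → ℂ} (hf : ContDiff ℝ 1 f)
    (hper : ∀ i z, f (z + P i) = f z) {w : E} (hw : w ∈ Set.range (combMap P)) :
    ∫ x in Set.Icc (0 : Fin (m + 1) → ℝ) 1, fderiv ℝ f (combMap P x) w = 0 := by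
  obtain ⟨c, rfl⟩ := hw
  have hd : ∀ x, HasFDerivAt (fun x => f (combMap P x)) (fderiv ℝ f (combMap P x) ∘L combMap P) x :=
    fun x => ((hf.differentiable one_ne_zero) _).hasFDerivAt.comp x (combMap P).hasFDerivAt
  have hsum : ∀ x, ∑ i, (c i • (fderiv ℝ f (combMap P x) ∘L combMap P)) (Pi.single i 1) =
      fderiv ℝ f (combMap P x) (combMap P c) := by
    intro x
    simp [combMap_single, combMap_apply P c]
  -- Divergence theorem on the unit box for the vector field with components `c i • f ∘ combMap P`.
  -- By the chain rule its divergence is the derivative of `f` along `∑ c i • P i`.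
  have key := MeasureTheory.integral_divergence_of_hasFDerivAt_off_countable
    (0 : Fin (m + 1) → ℝ) 1 zero_le_one (fun x i => c i • f (combMap P x))
    (fun x => ContinuousLinearMap.pi fun i => c i • (fderiv ℝ f (combMap P x) ∘L combMap P)) ∅
    Set.countable_empty
    (continuous_pi fun i =>
      (hf.continuous.comp (combMap P).continuous).const_smul (c i)).continuousOn
    (fun x _ => hasFDerivAt_pi.mpr fun i => (hd x).const_smul (c i))
    (by
      simp only [ContinuousLinearMap.pi_apply, hsum]
      exact (continuous_fderiv_combMap P hf _).continuousOn.integrableOn_compact isCompact_Icc)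
  simp only [ContinuousLinearMap.pi_apply, hsum] at key
  rw [key]
  refine Finset.sum_eq_zero fun i _ => sub_eq_zero.mpr ?_
  refine MeasureTheory.integral_congr_ae (Filter.Eventually.of_forall fun y => ?_)
  -- Opposite faces differ by the period `P i`, so their fluxes cancel.
  have h : (i.insertNth (1 : ℝ) y : Fin (m + 1) → ℝ) = i.insertNth (0 : ℝ) y + Pi.single i 1 := by
    funext j
    refine Fin.succAboveCases i ?_ (fun k => ?_) j
    · simp
    · simp
  simp only [Pi.one_apply, Pi.zero_apply]
  rw [h, map_add, combMap_single, hper]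

/-! ### The antiholomorphic derivative -/

/-- The antiholomorphic derivative `∂̄_v f = (D_v f + i D_{iv} f) / 2` of a function. -/
noncomputable def dbar {n : ℕ} (f : (Fin n → ℂ) → ℂ) (z v : Fin n → ℂ) : ℂ :=
  (1 / 2 : ℂ) * (fderiv ℝ f z v + Complex.I * fderiv ℝ f z (Complex.I • v))

theorem dbar_congr {n : ℕ} {f g : (Fin n → ℂ) → ℂ} {z : Fin n → ℂ} (h : f =ᶠ[nhds z] g)
    (v : Fin n → ℂ) : dbar f z v = dbar g z v := by
  simp only [dbar, h.fderiv_eq]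

theorem dbar_add {n : ℕ} {f g : (Fin n → ℂ) → ℂ} {z : Fin n → ℂ}
    (hf : DifferentiableAt ℝ f z) (hg : DifferentiableAt ℝ g z) (v : Fin n → ℂ) :
    dbar (fun w => f w + g w) z v = dbar f z v + dbar g z v := by
  simp only [dbar, fderiv_fun_add hf hg, add_apply]
  ring

theorem dbar_mul {n : ℕ} {f g : (Fin n → ℂ) → ℂ} {z : Fin n → ℂ}
    (hf : DifferentiableAt ℝ f z) (hg : DifferentiableAt ℝ g z) (v : Fin n → ℂ) :
    dbar (fun w => f w * g w) z v = f z * dbar g z v + g z * dbar f z v := by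
  simp only [dbar, fderiv_fun_mul hf hg, add_apply,
    smul_apply, smul_eq_mul]
  ring

theorem dbar_const_mul {n : ℕ} {f : (Fin n → ℂ) → ℂ} {z : Fin n → ℂ}
    (hf : DifferentiableAt ℝ f z) (c : ℂ) (v : Fin n → ℂ) :
    dbar (fun w => c * f w) z v = c * dbar f z v := by
  simp only [dbar, fderiv_const_mul hf, smul_apply, smul_eq_mul]
  ring

theorem dbar_eq_zero_of_differentiableAt {n : ℕ} {f : (Fin n → ℂ) → ℂ} {z : Fin n → ℂ}
    (hf : DifferentiableAt ℂ f z) (v : Fin n → ℂ) : dbar f z v = 0 := by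
  rw [dbar, hf.fderiv_restrictScalars ℝ]
  simp only [ContinuousLinearMap.coe_restrictScalars', map_smul, smul_eq_mul]
  rw [← mul_assoc, Complex.I_mul_I]
  ring

/-- Cauchy–Riemann: the hypothesis says that the real differential commutes with multiplication by
`i`, hence is complex linear. -/
theorem differentiableAt_of_dbar_eq_zero {n : ℕ} {f : (Fin n → ℂ) → ℂ} {z : Fin n → ℂ}
    (hf : DifferentiableAt ℝ f z) (h : ∀ v, dbar f z v = 0) : DifferentiableAt ℂ f z := by
  refine (differentiableAt_iff_restrictScalars ℝ hf).mpr ?_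
  have hI : ∀ v, fderiv ℝ f z (Complex.I • v) = Complex.I * fderiv ℝ f z v := by
    intro v
    have hv := h v
    rw [dbar] at hv
    linear_combination (-2 * Complex.I) * hv + (fderiv ℝ f z (Complex.I • v)) * Complex.I_mul_I
  refine ⟨⟨⟨(fderiv ℝ f z : (Fin n → ℂ) →ₗ[ℝ] ℂ).toAddHom, fun c v => ?_⟩,
    (fderiv ℝ f z).continuous⟩, ?_⟩
  · have hc : c • v = c.re • v + c.im • (Complex.I • v) := by
      funext i
      simp only [Pi.smul_apply, Pi.add_apply, smul_eq_mul, Complex.real_smul]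
      rw [← mul_assoc, ← add_mul, Complex.re_add_im]
    change fderiv ℝ f z (c • v) = c • fderiv ℝ f z v
    rw [hc, map_add, map_smul, map_smul, hI, Complex.real_smul, Complex.real_smul, ← mul_assoc,
      ← add_mul, Complex.re_add_im, smul_eq_mul]
  · ext v; rfl

theorem ContDiffAt.dbar {n : ℕ} {f : (Fin n → ℂ) → ℂ} {z : Fin n → ℂ}
    (hf : ContDiffAt ℝ ∞ f z) (v : Fin n → ℂ) : ContDiffAt ℝ ∞ (fun w => dbar f w v) z := by
  have h : ContDiffAt ℝ ∞ (fderiv ℝ f) z := hf.fderiv_right (by simp)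
  exact contDiffAt_const.mul ((h.clm_apply contDiffAt_const).add
    (contDiffAt_const.mul (h.clm_apply contDiffAt_const)))

/-- Antiholomorphic derivatives commute. -/
theorem dbar_dbar_comm {n : ℕ} {f : (Fin n → ℂ) → ℂ} {z : Fin n → ℂ}
    (hf : ContDiffAt ℝ ∞ f z) (u v : Fin n → ℂ) :
    dbar (fun w => dbar f w v) z u = dbar (fun w => dbar f w u) z v := by
  have hd : DifferentiableAt ℝ (fderiv ℝ f) z :=
    (hf.fderiv_right (m := ∞) (by simp)).differentiableAt (by simp)
  have hfd : ∀ v u, fderiv ℝ (fun w => dbar f w v) z u = (1 / 2 : ℂ) *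
      (fderiv ℝ (fderiv ℝ f) z u v + Complex.I * fderiv ℝ (fderiv ℝ f) z u (Complex.I • v)) := by
    intro v u
    have h1 : ∀ v, HasFDerivAt (fun w => fderiv ℝ f w v)
        ((fderiv ℝ (fderiv ℝ f) z).flip v) z := fun v => by
      simpa using hd.hasFDerivAt.clm_apply (hasFDerivAt_const v z)
    have h2 := ((h1 v).add ((h1 (Complex.I • v)).const_mul Complex.I)).const_mul (1 / 2 : ℂ)
    refine (congrArg (fun L => L u) h2.fderiv).trans ?_
    simp only [smul_apply, add_apply, ContinuousLinearMap.flip_apply, smul_eq_mul]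
  have hs : ∀ u v, fderiv ℝ (fderiv ℝ f) z u v = fderiv ℝ (fderiv ℝ f) z v u :=
    fun u v => hf.isSymmSndFDerivAt (by simp [ENat.LEInfty.out]) u v
  rw [_root_.dbar, _root_.dbar, hfd, hfd, hfd, hfd, hs v u, hs (Complex.I • u) v,
    hs u (Complex.I • v), hs (Complex.I • u) (Complex.I • v)]
  ring

/-- Logarithmic antiholomorphic derivatives are `∂̄`-exact. -/
theorem exists_dbar_eq_dbar_div {n : ℕ} {g : (Fin n → ℂ) → ℂ} {z : Fin n → ℂ}
    (hg : ContDiffAt ℝ ∞ g z) (h0 : g z ≠ 0) :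
    ∃ L : (Fin n → ℂ) → ℂ, ContDiffAt ℝ ∞ L z ∧
      ∀ᶠ w in nhds z, ∀ v, dbar L w v = dbar g w v / g w := by
  -- Dividing by the constant `g z` moves the value to `1`, away from the branch cut, and does not
  -- change logarithmic derivatives.
  have hmem : (g z)⁻¹ * g z ∈ Complex.slitPlane := by simp [h0]
  have hc : ContDiffAt ℝ ∞ (fun w => (g z)⁻¹ * g w) z := contDiffAt_const.mul hg
  refine ⟨fun w => Complex.log ((g z)⁻¹ * g w), ?_, ?_⟩
  · exact ((Complex.contDiffAt_log (n := ∞) hmem).restrict_scalars ℝ).comp z hc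
  · have h1 : ∀ᶠ w in nhds z, (g z)⁻¹ * g w ∈ Complex.slitPlane :=
      hc.continuousAt.eventually (Complex.isOpen_slitPlane.mem_nhds hmem)
    have h2 : ∀ᶠ w in nhds z, DifferentiableAt ℝ g w := by
      have h3 : ContDiffAt ℝ 1 g z := hg.of_le (by simp)
      filter_upwards [h3.eventually (by simp)] with w hw using hw.differentiableAt one_ne_zero
    filter_upwards [h1, h2] with w hw hd v
    have h4 := ((Complex.hasDerivAt_log hw).complexToReal_fderiv).comp w
      (hd.hasFDerivAt.const_mul (g z)⁻¹)
    have h6 : ∀ v, fderiv ℝ (fun w => Complex.log ((g z)⁻¹ * g w)) w v =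
        ((g z)⁻¹ * g w)⁻¹ * ((g z)⁻¹ * fderiv ℝ g w v) := fun v => congrArg (fun L => L v) h4.fderiv
    simp only [_root_.dbar, h6]
    have h5 : g w ≠ 0 := fun h => by simp [h] at hw
    field_simp

/-! ### Real coordinates and periodic functions -/

/-- The decomposition `z = x + T y`. -/
theorem coordX_add_mulVec_coordY {n : ℕ} (T : Matrix (Fin n) (Fin n) ℂ)
    (hT : (T.map Complex.im).det ≠ 0) (z : Fin n → ℂ) :
    (fun i => (coordX T z i : ℂ)) + T *ᵥ (fun i => (coordY T z i : ℂ)) = z := by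
  have hY : T.map Complex.im *ᵥ coordY T z = fun i => (z i).im := by
    simp only [coordY, LinearMap.comp_apply, Matrix.mulVecLin_apply, Matrix.mulVec_mulVec]
    rw [Matrix.mul_nonsing_inv _ (isUnit_iff_ne_zero.mpr hT), Matrix.one_mulVec]
    rfl
  funext i
  apply Complex.ext
  · simp [re_mulVec_ofReal, coordX]
  · simp [im_mulVec_ofReal, hY]

/-- The generators of the lattice of periods. -/
noncomputable def periodBasis {n : ℕ} (T : Matrix (Fin n) (Fin n) ℂ) :
    Fin n ⊕ Fin n → (Fin n → ℂ) :=
  Sum.elim (fun i => period T (Pi.single i 1, 0)) (fun i => period T (0, Pi.single i 1))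

theorem periodBasis_inl {n : ℕ} (T : Matrix (Fin n) (Fin n) ℂ) (i : Fin n) :
    periodBasis T (Sum.inl i) = (2 * Real.pi) • (Pi.single i 1 : Fin n → ℂ) := by
  funext k
  simp only [periodBasis, Sum.elim_inl, period_eq]
  rcases eq_or_ne k i with rfl | h
  · simp [Matrix.mulVec, dotProduct]
  · simp [Matrix.mulVec, dotProduct, h]

theorem periodBasis_inr {n : ℕ} (T : Matrix (Fin n) (Fin n) ℂ) (i : Fin n) :
    periodBasis T (Sum.inr i) = (2 * Real.pi) • T.col i := by
  funext k
  simp only [periodBasis, Sum.elim_inr, period_eq, Matrix.mulVec, dotProduct, Pi.add_apply]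
  rw [Finset.sum_eq_single i (fun j _ hj => by simp [hj]) (by simp)]
  simp [mul_comm]

/-- The periods span `ℂⁿ` over the reals, so the mean value argument applies to every direction, in
particular to both `w` and `i w`. -/
theorem range_combMap_periodBasis {n : ℕ} (T : Matrix (Fin n) (Fin n) ℂ)
    (hT : (T.map Complex.im).det ≠ 0) {ι : Type*} [Fintype ι] (e : ι ≃ Fin n ⊕ Fin n)
    (w : Fin n → ℂ) : w ∈ Set.range (combMap (periodBasis T ∘ e)) := by
  have hpi : (2 * Real.pi : ℝ) ≠ 0 := by positivity
  refine ⟨fun i => (2 * Real.pi)⁻¹ * Sum.elim (coordX T w) (coordY T w) (e i), ?_⟩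
  simp only [combMap_apply, Function.comp_apply]
  rw [e.sum_comp (fun s => ((2 * Real.pi)⁻¹ * Sum.elim (coordX T w) (coordY T w) s) •
    periodBasis T s), Fintype.sum_sum_type]
  conv_rhs => rw [← coordX_add_mulVec_coordY T hT w]
  have hs : ∀ (a : ℝ) (x : Fin n → ℂ), ((2 * Real.pi)⁻¹ * a) • (2 * Real.pi) • x = a • x := by
    intro a x
    rw [smul_smul]
    congr 1
    field_simp
  simp only [Sum.elim_inl, Sum.elim_inr, periodBasis_inl, periodBasis_inr, hs]
  congr 1
  · funext k
    simp [Finset.sum_apply, Pi.single_apply]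
  · funext k
    simp [Finset.sum_apply, Matrix.mulVec, dotProduct, mul_comm]

/-- A constant of the form `∂̄_u b_v - ∂̄_v b_u`, with periodic `b_u` and `b_v`, vanishes. -/
theorem eq_zero_of_dbar_sub_dbar_eq_const {n : ℕ} (T : Matrix (Fin n) (Fin n) ℂ)
    (hT : (T.map Complex.im).det ≠ 0) {b b' : (Fin n → ℂ) → ℂ}
    (hb : ContDiff ℝ 1 b) (hb' : ContDiff ℝ 1 b')
    (hper : ∀ l z, b (z + period T l) = b z) (hper' : ∀ l z, b' (z + period T l) = b' z)
    {u v : Fin n → ℂ} {c : ℂ} (hc : ∀ z, dbar b z u - dbar b' z v = c) : c = 0 := by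
  rcases n with _ | n
  -- In dimension zero every direction is the zero vector, so both derivatives vanish.
  · rw [← hc 0]
    simp only [dbar, Subsingleton.elim u 0, Subsingleton.elim v 0, smul_zero, map_zero, mul_zero,
      add_zero, sub_zero]
  -- The divergence theorem is stated in a successor dimension, so the `2(n + 1)` periods are
  -- reindexed accordingly.
  · have hcard : n + 1 + (n + 1) = (n + n + 1) + 1 := by omega
    let e : Fin (n + n + 1 + 1) ≃ Fin (n + 1) ⊕ Fin (n + 1) :=
      (finCongr hcard.symm).trans finSumFinEquiv.symm
    let P := periodBasis T ∘ e
    have hP : ∀ {f : (Fin (n + 1) → ℂ) → ℂ}, (∀ l z, f (z + period T l) = f z) →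
        ∀ i z, f (z + P i) = f z := by
      intro f hf i z
      simp only [P, Function.comp_apply]
      rcases e i with j | j
      · exact hf _ z
      · exact hf _ z
    have key : ∀ {f : (Fin (n + 1) → ℂ) → ℂ}, ContDiff ℝ 1 f →
        (∀ l z, f (z + period T l) = f z) → ∀ w,
        MeasureTheory.IntegrableOn (fun x => dbar f (combMap P x) w)
          (Set.Icc (0 : Fin (n + n + 1 + 1) → ℝ) 1) ∧
        ∫ x in Set.Icc (0 : Fin (n + n + 1 + 1) → ℝ) 1, dbar f (combMap P x) w = 0 := by
      intro f hf hfp w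
      have hi : ∀ w, MeasureTheory.IntegrableOn (fun x => fderiv ℝ f (combMap P x) w)
          (Set.Icc (0 : Fin (n + n + 1 + 1) → ℝ) 1) := fun w =>
        (continuous_fderiv_combMap P hf w).continuousOn.integrableOn_compact isCompact_Icc
      have h0 : ∀ w, ∫ x in Set.Icc (0 : Fin (n + n + 1 + 1) → ℝ) 1,
          fderiv ℝ f (combMap P x) w = 0 := fun w =>
        integral_fderiv_eq_zero_of_periodic P hf (hP hfp) (range_combMap_periodBasis T hT e w)
      constructor
      · exact ((hi w).add ((hi (Complex.I • w)).const_mul Complex.I)).const_mul (1 / 2)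
      · simp only [dbar]
        rw [MeasureTheory.integral_const_mul,
          MeasureTheory.integral_add (hi w) ((hi (Complex.I • w)).const_mul Complex.I),
          MeasureTheory.integral_const_mul, h0, h0]
        simp
    have h1 := MeasureTheory.integral_sub (key hb hper u).1 (key hb' hper' v).1
    simp only [hc, (key hb hper u).2, (key hb' hper' v).2, sub_zero] at h1
    -- The parameter box has volume `1`, so the integral of the constant is `c` itself.
    rw [MeasureTheory.setIntegral_const] at h1
    simpa [MeasureTheory.measureReal_def, Real.volume_Icc_pi] using h1

/-! ### Determinants of matrices of functions -/

theorem contDiffOn_det {n N : ℕ} {s : Set (Fin n → ℂ)}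
    {M : (Fin n → ℂ) → Matrix (Fin N) (Fin N) ℂ} (hM : ∀ i j, ContDiffOn ℝ ∞ (fun z => M z i j) s) :
    ContDiffOn ℝ ∞ (fun z => (M z).det) s := by
  simp only [Matrix.det_apply]
  exact ContDiffOn.sum fun σ _ => (contDiffOn_prod fun i _ => hM (σ i) i).const_smul _

theorem differentiableOn_det {n N : ℕ} {s : Set (Fin n → ℂ)}
    {M : (Fin n → ℂ) → Matrix (Fin N) (Fin N) ℂ}
    (hM : ∀ i j, DifferentiableOn ℂ (fun z => M z i j) s) :
    DifferentiableOn ℂ (fun z => (M z).det) s := by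
  simp only [Matrix.det_apply]
  exact DifferentiableOn.fun_sum fun σ _ =>
    DifferentiableOn.const_smul (fun z hz => (HasFDerivWithinAt.finsetProd (u := Finset.univ)
      fun i _ => (hM (σ i) i z hz).hasFDerivWithinAt).differentiableWithinAt) _

/-- If `dM = M ⊗ s`, then `d (det M) = N (det M) s`. -/
theorem hasFDerivAt_det_of_smul {n N : ℕ} {z : Fin n → ℂ}
    {M : (Fin n → ℂ) → Matrix (Fin N) (Fin N) ℂ} {s : (Fin n → ℂ) →L[ℝ] ℂ}
    (hM : ∀ i j, HasFDerivAt (fun z => M z i j) (M z i j • s) z) :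
    HasFDerivAt (fun z => (M z).det) ((N * (M z).det) • s) z := by
  have hp : ∀ σ : Equiv.Perm (Fin N), HasFDerivAt (fun z => ∏ i, M z (σ i) i)
      ((N * ∏ i, M z (σ i) i) • s) z := by
    intro σ
    refine (HasFDerivAt.finsetProd (u := Finset.univ) fun i _ => hM (σ i) i).congr_fderiv ?_
    -- Each of the `N` factors contributes the whole product times `s`.
    simp only [smul_smul, Finset.prod_erase_mul _ _ (Finset.mem_univ _), Finset.sum_const,
      Finset.card_univ, Fintype.card_fin, ← Nat.cast_smul_eq_nsmul ℂ]
  simp only [Matrix.det_apply]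
  refine (HasFDerivAt.fun_sum fun σ _ =>
    (hp σ).const_smul (Equiv.Perm.sign σ : ℤˣ)).congr_fderiv ?_
  ext v
  simp only [sum_apply, smul_apply, smul_eq_mul, Finset.mul_sum,
    Finset.sum_mul, Units.smul_def, zsmul_eq_mul]
  exact Finset.sum_congr rfl fun σ _ => by ring

/-! ### Frames -/

theorem ComplexTorus.mk_add_period {n : ℕ} (T : Matrix (Fin n) (Fin n) ℂ)
    (l : (Fin n → ℤ) × (Fin n → ℤ)) (z : Fin n → ℂ) :
    ComplexTorus.mk T (z + period T l) = ComplexTorus.mk T z := by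
  refine (QuotientAddGroup.eq.mpr ?_).symm
  exact ⟨l, by abel⟩

theorem ComplexTorus.exists_of_mk_eq {n : ℕ} {T : Matrix (Fin n) (Fin n) ℂ} {z w : Fin n → ℂ}
    (h : ComplexTorus.mk T z = ComplexTorus.mk T w) : ∃ l, w = z + period T l := by
  obtain ⟨l, hl⟩ := QuotientAddGroup.eq.mp h
  exact ⟨l, by rw [hl]; abel⟩

theorem ComplexTorus.isOpen_mk_preimage {n : ℕ} {T : Matrix (Fin n) (Fin n) ℂ}
    {U : Set (ComplexTorus T)} (hU : IsOpen U) : IsOpen (ComplexTorus.mk T ⁻¹' U) :=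
  hU.preimage QuotientAddGroup.continuous_mk

/-! ### Determinants of holomorphic frames and the obstruction to a holomorphic structure -/

namespace TorusBundle

variable {n N : ℕ} {T : Matrix (Fin n) (Fin n) ℂ} {E : TorusBundle T N}

theorem isUnit_factor (E : TorusBundle T N) (l : (Fin n → ℤ) × (Fin n → ℤ)) (z : Fin n → ℂ) :
    IsUnit (E.factor l z) := by
  have h := E.cocycle (-l) l z
  rw [neg_add_cancel, E.factor_zero] at h
  exact IsUnit.of_mul_eq_one_right _ h.symm

/-- The matrix whose columns are the sections of the frame. -/
def LocalFrame.matrix (f : E.LocalFrame) (z : Fin n → ℂ) : Matrix (Fin N) (Fin N) ℂ :=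
  Matrix.of fun i j => f.sec j z i

theorem LocalFrame.contDiffOn_matrix (f : E.LocalFrame) (i j : Fin N) :
    ContDiffOn ℝ ∞ (fun z => f.matrix z i j) (ComplexTorus.mk T ⁻¹' f.base) :=
  contDiffOn_pi.mp (f.isSmoothSection j).smooth i

theorem LocalFrame.det_ne_zero (f : E.LocalFrame) {z : Fin n → ℂ}
    (hz : z ∈ ComplexTorus.mk T ⁻¹' f.base) : (f.matrix z).det ≠ 0 := by
  have h : IsUnit (f.matrix z) :=
    Matrix.linearIndependent_cols_iff_isUnit.mp (f.linearIndependent z hz)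
  exact ((Matrix.isUnit_iff_isUnit_det _).mp h).ne_zero

theorem LocalFrame.contDiffAt_det (f : E.LocalFrame) {z : Fin n → ℂ}
    (hz : z ∈ ComplexTorus.mk T ⁻¹' f.base) : ContDiffAt ℝ ∞ (fun z => (f.matrix z).det) z :=
  (contDiffOn_det f.contDiffOn_matrix).contDiffAt
    ((ComplexTorus.isOpen_mk_preimage f.isOpen_base).mem_nhds hz)

theorem LocalFrame.matrix_add_period (f : E.LocalFrame) {z : Fin n → ℂ}
    (hz : z ∈ ComplexTorus.mk T ⁻¹' f.base) (l : (Fin n → ℤ) × (Fin n → ℤ)) :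
    f.matrix (z + period T l) = E.factor l z * f.matrix z := by
  ext i j
  exact congrFun ((f.isSmoothSection j).equivariant l z hz) i

/-- The antiholomorphic logarithmic derivative of the determinant of a frame. -/
noncomputable def LocalFrame.dlogDet (f : E.LocalFrame) (z v : Fin n → ℂ) : ℂ :=
  dbar (fun z => (f.matrix z).det) z v / (f.matrix z).det

/-- The two determinants differ by the determinant of the transition matrix, which is holomorphic
and nowhere zero on the overlap, so `∂̄ log` does not see it. -/
theorem HolomorphicStructure.dlogDet_eq (H : E.HolomorphicStructure) {f f' : E.LocalFrame}
    (hf : f ∈ H.frames) (hf' : f' ∈ H.frames) {z : Fin n → ℂ}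
    (hz : z ∈ ComplexTorus.mk T ⁻¹' f.base) (hz' : z ∈ ComplexTorus.mk T ⁻¹' f'.base)
    (v : Fin n → ℂ) : f'.dlogDet z v = f.dlogDet z v := by
  obtain ⟨h, hh, htr⟩ := H.holomorphic f hf f' hf'
  have hopen := ComplexTorus.isOpen_mk_preimage (f.isOpen_base.inter f'.isOpen_base)
  have hmem : ComplexTorus.mk T ⁻¹' (f.base ∩ f'.base) ∈ nhds z := hopen.mem_nhds ⟨hz, hz'⟩
  have hdet : ∀ w ∈ ComplexTorus.mk T ⁻¹' (f.base ∩ f'.base),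
      (f'.matrix w).det = (f.matrix w).det * (h w).det := by
    intro w hw
    rw [← Matrix.det_mul]
    congr 1
    ext i j
    have := congrFun (htr w hw j) i
    rw [Finset.sum_apply] at this
    rw [Matrix.mul_apply]
    refine this.trans (Finset.sum_congr rfl fun k _ => ?_)
    simp [LocalFrame.matrix, mul_comm]
  have hd : DifferentiableAt ℂ (fun w => (h w).det) z := (differentiableOn_det hh).differentiableAt hmem
  have h0 : (h z).det ≠ 0 := by
    have := f'.det_ne_zero hz'
    rw [hdet z ⟨hz, hz'⟩] at this
    exact right_ne_zero_of_mul this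
  rw [LocalFrame.dlogDet, dbar_congr (Filter.eventually_of_mem hmem hdet),
    dbar_mul ((f.contDiffAt_det hz).differentiableAt (by simp)) (hd.restrictScalars ℝ),
    dbar_eq_zero_of_differentiableAt hd, hdet z ⟨hz, hz'⟩, LocalFrame.dlogDet, mul_zero, zero_add,
    mul_comm (h z).det, mul_div_mul_right _ _ h0]

namespace Connection

variable {D : E.Connection} {θ : (Fin n → ℂ) → (Fin n → ℂ) →ₗ[ℝ] ℂ}

/-- The differential of the transition functions, for a connection with scalar connection form. -/
theorem hasFDerivAt_factor (hθ : ∀ z v, D.form z v = θ z v • 1) (l : (Fin n → ℤ) × (Fin n → ℤ))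
    (z : Fin n → ℂ) (i j : Fin N) :
    HasFDerivAt (fun w => E.factor l w i j)
      (E.factor l z i j • LinearMap.toContinuousLinearMap (θ z - θ (z + period T l))) z := by
  refine (((E.smooth l i j).differentiable (by simp)) z).hasFDerivAt.congr_fderiv ?_
  ext v
  have h := congrFun (congrFun (D.compat l z v) i) j
  simp only [hθ, Matrix.add_apply, Matrix.of_apply, smul_mul_assoc, one_mul, mul_smul_comm, mul_one,
    Matrix.smul_apply, smul_eq_mul] at h
  simp only [smul_apply, smul_eq_mul, LinearMap.coe_toContinuousLinearMap', LinearMap.sub_apply]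
  linear_combination h

/-- The `(0,1)`-part of a scalar connection form. -/
noncomputable def formBar (θ : (Fin n → ℂ) → (Fin n → ℂ) →ₗ[ℝ] ℂ) (z v : Fin n → ℂ) : ℂ :=
  (1 / 2 : ℂ) * (θ z v + Complex.I * θ z (Complex.I • v))

/-- A translation multiplies the determinant of the frame by that of the factor of automorphy, whose
logarithmic differential is `N (θ z - θ (z + period T l))` by compatibility of the connection.
Consequently `N θ^{0,1}` plus the logarithmic derivative is periodic. -/
theorem dlogDet_add_period (hθ : ∀ z v, D.form z v = θ z v • 1) (f : E.LocalFrame)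
    {z : Fin n → ℂ} (hz : z ∈ ComplexTorus.mk T ⁻¹' f.base) (l : (Fin n → ℤ) × (Fin n → ℤ))
    (v : Fin n → ℂ) :
    f.dlogDet (z + period T l) v =
      f.dlogDet z v + N * (formBar θ z v - formBar θ (z + period T l) v) := by
  have hopen := ComplexTorus.isOpen_mk_preimage f.isOpen_base
  have hF := hasFDerivAt_det_of_smul fun i j => hasFDerivAt_factor hθ l z i j
  have hF0 : (E.factor l z).det ≠ 0 :=
    ((Matrix.isUnit_iff_isUnit_det _).mp (E.isUnit_factor l z)).ne_zero
  have hshift : dbar (fun w => (f.matrix w).det) (z + period T l) v =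
      dbar (fun w => (f.matrix (w + period T l)).det) z v := by
    simp only [dbar]
    rw [fderiv_comp_add_right (f := fun w => (f.matrix w).det)]
  have hev : (fun w => (f.matrix (w + period T l)).det) =ᶠ[nhds z]
      fun w => (E.factor l w).det * (f.matrix w).det := by
    filter_upwards [hopen.mem_nhds hz] with w hw
    rw [f.matrix_add_period hw, Matrix.det_mul]
  have hdF : dbar (fun w => (E.factor l w).det) z v =
      (E.factor l z).det * (N * (formBar θ z v - formBar θ (z + period T l) v)) := by
    simp only [dbar, hF.fderiv, smul_apply, smul_eq_mul, LinearMap.coe_toContinuousLinearMap',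
      LinearMap.sub_apply, formBar]
    ring
  rw [LocalFrame.dlogDet, hshift, dbar_congr hev, dbar_mul hF.differentiableAt
    ((f.contDiffAt_det hz).differentiableAt (by simp)), hdF, f.matrix_add_period hz, Matrix.det_mul,
    LocalFrame.dlogDet]
  have := f.det_ne_zero hz
  field_simp

/-- If the `(0,2)`-part of the curvature of a connection with scalar connection form is constant
and the bundle admits a holomorphic structure, then this `(0,2)`-part vanishes. -/
theorem eq_zero_of_admitsHolomorphicStructure (hT : (T.map Complex.im).det ≠ 0) (hN : 0 < N)
    (hθ : ∀ z v, D.form z v = θ z v • 1) (hE : E.AdmitsHolomorphicStructure) {u v : Fin n → ℂ}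
    {c : ℂ} (hc : ∀ z, dbar (fun w => formBar θ w v) z u - dbar (fun w => formBar θ w u) z v = c) :
    c = 0 := by
  obtain ⟨H⟩ := hE
  choose fr hfr hmem using H.cover
  have hsm : ∀ v, ContDiff ℝ ∞ fun w => θ w v := by
    intro v
    -- Positive rank supplies a diagonal entry from which the scalar form can be read off.
    have h := D.smooth v ⟨0, hN⟩ ⟨0, hN⟩
    simpa [hθ] using h
  have hsmBar : ∀ v, ContDiff ℝ ∞ fun w => formBar θ w v := fun v =>
    contDiff_const.mul ((hsm v).add (contDiff_const.mul (hsm _)))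
  -- The global form `β`. The frame is chosen separately at each point of the torus, with no
  -- continuity; frame independence makes `b` smooth all the same.
  let b : (Fin n → ℂ) → (Fin n → ℂ) → ℂ := fun v z =>
    N * formBar θ z v + (fr (ComplexTorus.mk T z)).dlogDet z v
  -- Near `z₀` the frame chosen at `z₀` may be used throughout, and `L` is a logarithm of its
  -- determinant.
  have hloc : ∀ z₀, ∃ L : (Fin n → ℂ) → ℂ, ContDiffAt ℝ ∞ L z₀ ∧
      ∀ v, b v =ᶠ[nhds z₀] fun z => N * formBar θ z v + dbar L z v := by
    intro z₀
    let f := fr (ComplexTorus.mk T z₀)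
    have hz₀ : z₀ ∈ ComplexTorus.mk T ⁻¹' f.base := hmem _
    obtain ⟨L, hL, hdL⟩ := exists_dbar_eq_dbar_div (f.contDiffAt_det hz₀) (f.det_ne_zero hz₀)
    refine ⟨L, hL, fun v => ?_⟩
    filter_upwards [hdL, (ComplexTorus.isOpen_mk_preimage f.isOpen_base).mem_nhds hz₀] with z hz hzf
    rw [hz v]
    exact congrArg (_ + ·) (H.dlogDet_eq (hfr _) (hfr _) hzf (hmem _) v)
  have hbs : ∀ v, ContDiff ℝ 1 (b v) := by
    intro v
    refine contDiff_iff_contDiffAt.mpr fun z₀ => ?_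
    obtain ⟨L, hL, hb⟩ := hloc z₀
    have h : ContDiffAt ℝ ∞ (fun z => N * formBar θ z v + dbar L z v) z₀ :=
      (contDiffAt_const.mul (hsmBar v).contDiffAt).add (hL.dbar v)
    exact (h.of_le (by simp)).congr_of_eventuallyEq (hb v)
  have hbp : ∀ v l z, b v (z + period T l) = b v z := by
    intro v l z
    simp only [b, ComplexTorus.mk_add_period]
    rw [dlogDet_add_period hθ _ (hmem _)]
    ring
  have hN' : (N : ℂ) ≠ 0 := by exact_mod_cast hN.ne'
  refine (mul_eq_zero.mp (eq_zero_of_dbar_sub_dbar_eq_const T hT (hbs v) (hbs u) (hbp v) (hbp u)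
    (c := N * c) (u := u) (v := v) fun z => ?_)).resolve_left hN'
  obtain ⟨L, hL, hb⟩ := hloc z
  have hd : ∀ v, DifferentiableAt ℝ (fun w => formBar θ w v) z := fun v =>
    ((hsmBar v).differentiable (by simp)) z
  have hdL : ∀ v, DifferentiableAt ℝ (fun w => dbar L w v) z := fun v =>
    (hL.dbar v).differentiableAt (by simp)
  -- The second derivatives of `L` cancel by symmetry, leaving `N` times the curvature constant.
  rw [dbar_congr (hb v), dbar_congr (hb u), dbar_add ((hd v).const_mul _) (hdL v),
    dbar_add ((hd u).const_mul _) (hdL u), dbar_const_mul (hd v), dbar_const_mul (hd u),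
    dbar_dbar_comm hL u v, ← hc z]
  ring

end Connection

end TorusBundle

/-! ### Transition matrices between parallel frames -/

namespace TorusBundle

variable {n N : ℕ} {T : Matrix (Fin n) (Fin n) ℂ} {E : TorusBundle T N}

/-- The matrix expressing the frame `f'` in terms of the frame `f`. -/
noncomputable def LocalFrame.transition (f f' : E.LocalFrame) (z : Fin n → ℂ) :
    Matrix (Fin N) (Fin N) ℂ :=
  Matrix.of fun i j => (f.matrix z).det⁻¹ * (f.matrix z).cramer (f'.sec j z) i

/-- By Cramer's rule the entries are quotients of determinants with smooth entries, and the
denominator does not vanish. -/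
theorem LocalFrame.contDiffOn_transition (f f' : E.LocalFrame) (i j : Fin N) :
    ContDiffOn ℝ ∞ (fun z => f.transition f' z i j)
      (ComplexTorus.mk T ⁻¹' (f.base ∩ f'.base)) := by
  have h1 : ComplexTorus.mk T ⁻¹' (f.base ∩ f'.base) ⊆ ComplexTorus.mk T ⁻¹' f.base :=
    fun _ hz => hz.1
  have h2 : ComplexTorus.mk T ⁻¹' (f.base ∩ f'.base) ⊆ ComplexTorus.mk T ⁻¹' f'.base :=
    fun _ hz => hz.2
  simp only [transition, Matrix.of_apply, Matrix.cramer_apply]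
  refine (((contDiffOn_det f.contDiffOn_matrix).mono h1).inv fun z hz => f.det_ne_zero hz.1).mul
    (contDiffOn_det fun k m => ?_)
  simp only [Matrix.updateCol_apply]
  split_ifs
  · exact (f'.contDiffOn_matrix k j).mono h2
  · exact (f.contDiffOn_matrix k m).mono h1

theorem LocalFrame.sec_eq_sum_transition (f f' : E.LocalFrame) {z : Fin n → ℂ}
    (hz : z ∈ ComplexTorus.mk T ⁻¹' f.base) (j : Fin N) :
    f'.sec j z = ∑ i, f.transition f' z i j • f.sec i z := by
  have h := Matrix.mulVec_cramer (f.matrix z) (f'.sec j z)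
  funext k
  have hk := congrFun h k
  simp only [Matrix.mulVec, dotProduct, Pi.smul_apply, smul_eq_mul] at hk
  rw [Finset.sum_apply]
  simp only [transition, Matrix.of_apply, Pi.smul_apply, smul_eq_mul, mul_assoc]
  rw [← Finset.mul_sum, eq_inv_mul_iff_mul_eq₀ (f.det_ne_zero hz), ← hk]
  exact Finset.sum_congr rfl fun i _ => mul_comm _ _

namespace Connection

variable {D : E.Connection} {θ : (Fin n → ℂ) → (Fin n → ℂ) →ₗ[ℝ] ℂ}

theorem derivBar_apply (hθ : ∀ z v, D.form z v = θ z v • 1) {s : (Fin n → ℂ) → (Fin N → ℂ)}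
    {z : Fin n → ℂ} (hs : DifferentiableAt ℝ s z) (v : Fin n → ℂ) (k : Fin N) :
    D.derivBar s z v k = dbar (fun w => s w k) z v + formBar θ z v * s z k := by
  have h : ∀ v, fderiv ℝ (fun w => s w k) z v = fderiv ℝ s z v k := fun v =>
    congrArg (fun L => L v) (hasFDerivAt_pi'.mp hs.hasFDerivAt k).fderiv
  simp only [derivBar, deriv, dbar, formBar, hθ, h, Pi.smul_apply, Pi.add_apply, smul_eq_mul,
    Matrix.smul_mulVec, Matrix.one_mulVec]
  ring

/-- The transition matrix of two `∇^{0,1}`-parallel frames is holomorphic. -/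
theorem differentiableOn_transition (hθ : ∀ z v, D.form z v = θ z v • 1) {f f' : E.LocalFrame}
    (hf : ∀ j, ∀ z ∈ ComplexTorus.mk T ⁻¹' f.base, ∀ v, D.derivBar (f.sec j) z v = 0)
    (hf' : ∀ j, ∀ z ∈ ComplexTorus.mk T ⁻¹' f'.base, ∀ v, D.derivBar (f'.sec j) z v = 0)
    (i j : Fin N) : DifferentiableOn ℂ (fun z => f.transition f' z i j)
      (ComplexTorus.mk T ⁻¹' (f.base ∩ f'.base)) := by
  intro z hz
  have hopen := ComplexTorus.isOpen_mk_preimage (f.isOpen_base.inter f'.isOpen_base)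
  have hmem := hopen.mem_nhds hz
  have hd : ∀ i, DifferentiableAt ℝ (fun z => f.transition f' z i j) z := fun i =>
    ((f.contDiffOn_transition f' i j).contDiffAt hmem).differentiableAt (by simp)
  have hs : ∀ (g : E.LocalFrame), z ∈ ComplexTorus.mk T ⁻¹' g.base → ∀ i,
      DifferentiableAt ℝ (g.sec i) z := fun g hg i =>
    ((g.isSmoothSection i).smooth.contDiffAt
      ((ComplexTorus.isOpen_mk_preimage g.isOpen_base).mem_nhds hg)).differentiableAt (by simp)
  have hsk : ∀ i k, DifferentiableAt ℝ (fun w => f.sec i w k) z := fun i k =>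
    differentiableAt_pi.mp (hs f hz.1 i) k
  refine (differentiableAt_of_dbar_eq_zero (hd i) fun v => ?_).differentiableWithinAt
  have hsum : ∀ k, dbar (fun w => f'.sec j w k) z v =
      ∑ i, (f.transition f' z i j * dbar (fun w => f.sec i w k) z v +
        f.sec i z k * dbar (fun w => f.transition f' w i j) z v) := by
    intro k
    have hev : (fun w => f'.sec j w k) =ᶠ[nhds z]
        fun w => ∑ i, f.transition f' w i j * f.sec i w k := by
      filter_upwards [hmem] with w hw
      have := congrFun (f.sec_eq_sum_transition f' hw.1 j) k
      rw [Finset.sum_apply] at this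
      exact this
    rw [dbar_congr hev]
    have hF : ∀ v, fderiv ℝ (fun w => ∑ i, f.transition f' w i j * f.sec i w k) z v =
        ∑ i, fderiv ℝ (fun w => f.transition f' w i j * f.sec i w k) z v := by
      intro v
      rw [fderiv_fun_sum fun i _ => (hd i).fun_mul (hsk i k), sum_apply]
    rw [dbar, hF, hF, Finset.mul_sum, ← Finset.sum_add_distrib, Finset.mul_sum]
    refine Finset.sum_congr rfl fun i _ => ?_
    rw [← dbar_mul (hd i) (hsk i k), dbar]
  -- In the Leibniz expansion of `∇^{0,1}` applied to the `j`-th section of `f'`, the terms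
  -- containing `∇^{0,1}` of the sections of `f` drop out. What remains is the frame matrix of `f`
  -- applied to `∂̄` of a column of the transition matrix, and the frame matrix is invertible.
  have hzero : f.matrix z *ᵥ (fun i => dbar (fun w => f.transition f' w i j) z v) = 0 := by
    funext k
    have h1 : ∀ i, dbar (fun w => f.sec i w k) z v = -(formBar θ z v * f.sec i z k) := by
      intro i
      have h := congrFun (hf i z hz.1 v) k
      rw [derivBar_apply hθ (hs f hz.1 i), Pi.zero_apply] at h
      linear_combination h
    have h2 := congrFun (hf' j z hz.2 v) k
    rw [derivBar_apply hθ (hs f' hz.2 j), Pi.zero_apply, hsum,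
      congrFun (f.sec_eq_sum_transition f' hz.1 j) k, Finset.sum_apply, Finset.mul_sum,
      ← Finset.sum_add_distrib] at h2
    rw [Pi.zero_apply, ← h2, Matrix.mulVec, dotProduct]
    refine Finset.sum_congr rfl fun i _ => ?_
    rw [h1]
    simp only [LocalFrame.matrix, Matrix.of_apply, Pi.smul_apply, smul_eq_mul]
    ring
  have hu : IsUnit (f.matrix z) :=
    (Matrix.isUnit_iff_isUnit_det _).mpr (isUnit_iff_ne_zero.mpr (f.det_ne_zero hz.1))
  exact congrFun ((Matrix.mulVec_injective_iff_isUnit.mpr hu)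
    (hzero.trans (Matrix.mulVec_zero _).symm)) i

/-- A connection with scalar connection form is holomorphic as soon as there are
`∇^{0,1}`-parallel frames around every point. -/
theorem isHolomorphic_of_exists_frame (hθ : ∀ z v, D.form z v = θ z v • 1)
    (h : ∀ x, ∃ f : E.LocalFrame, x ∈ f.base ∧
      ∀ j, ∀ z ∈ ComplexTorus.mk T ⁻¹' f.base, ∀ v, D.derivBar (f.sec j) z v = 0) :
    D.IsHolomorphic := by
  refine ⟨⟨{f | ∀ j, ∀ z ∈ ComplexTorus.mk T ⁻¹' f.base, ∀ v, D.derivBar (f.sec j) z v = 0},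
    fun x => ?_, fun f hf f' hf' => ?_⟩, fun f hf => hf⟩
  · obtain ⟨f, hx, hf⟩ := h x
    exact ⟨f, hf, hx⟩
  · exact ⟨f.transition f', differentiableOn_transition hθ hf hf',
      fun z hz j => f.sec_eq_sum_transition f' hz.1 j⟩

end Connection

/-! ### Frames obtained by equivariant extension -/

/-- A neighbourhood of `z₀` which is disjoint from its translates under the lattice. -/
def cell (T : Matrix (Fin n) (Fin n) ℂ) (z₀ : Fin n → ℂ) : Set (Fin n → ℂ) :=
  {z | ∀ i, |coordX T (z - z₀) i| < Real.pi ∧ |coordY T (z - z₀) i| < Real.pi}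

theorem mem_cell_self (T : Matrix (Fin n) (Fin n) ℂ) (z₀ : Fin n → ℂ) : z₀ ∈ cell T z₀ := by
  intro i
  simp [Real.pi_pos]

theorem isOpen_cell (T : Matrix (Fin n) (Fin n) ℂ) (z₀ : Fin n → ℂ) : IsOpen (cell T z₀) := by
  have hX : Continuous fun z => coordX T (z - z₀) :=
    (coordX T).continuous_of_finiteDimensional.comp (continuous_id.sub continuous_const)
  have hY : Continuous fun z => coordY T (z - z₀) :=
    (coordY T).continuous_of_finiteDimensional.comp (continuous_id.sub continuous_const)
  simp only [cell, Set.ofPred_forall]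
  refine isOpen_iInter_of_finite fun i => IsOpen.and ?_ ?_
  · exact isOpen_lt ((continuous_apply i).comp hX).abs continuous_const
  · exact isOpen_lt ((continuous_apply i).comp hY).abs continuous_const

theorem int_eq_of_abs_lt_pi {a b : ℝ} {k k' : ℤ} (h : a - 2 * Real.pi * k = b)
    (h' : |b| < Real.pi) (h'' : |a - 2 * Real.pi * k'| < Real.pi) : k = k' := by
  have hpi := Real.pi_pos
  rw [← h] at h'
  rw [abs_lt] at h' h''
  have h1 : ((k - k' : ℤ) : ℝ) < 1 := by
    push_cast
    nlinarith
  have h2 : ((k' - k : ℤ) : ℝ) < 1 := by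
    push_cast
    nlinarith
  have h3 : k - k' < 1 := by exact_mod_cast h1
  have h4 : k' - k < 1 := by exact_mod_cast h2
  omega

/-- A cell has width `2π` in each real coordinate and is open, while distinct lattice points differ
by at least `2π` in some coordinate. -/
theorem eq_of_sub_period_mem_cell (hT : (T.map Complex.im).det ≠ 0) {z₀ z : Fin n → ℂ}
    {l l' : (Fin n → ℤ) × (Fin n → ℤ)} (h : z - period T l ∈ cell T z₀)
    (h' : z - period T l' ∈ cell T z₀) : l = l' := by
  have hX : ∀ l i, coordX T (z - period T l - z₀) i = coordX T (z - z₀) i - 2 * Real.pi * l.1 i := by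
    intro l i
    rw [sub_right_comm, map_sub, Pi.sub_apply, coordX_period T hT]
  have hY : ∀ l i, coordY T (z - period T l - z₀) i = coordY T (z - z₀) i - 2 * Real.pi * l.2 i := by
    intro l i
    rw [sub_right_comm, map_sub, Pi.sub_apply, coordY_period T hT]
  refine Prod.ext (funext fun i => ?_) (funext fun i => ?_)
  · exact int_eq_of_abs_lt_pi (hX l i).symm (h i).1 (hX l' i ▸ (h' i).1)
  · exact int_eq_of_abs_lt_pi (hY l i).symm (h i).2 (hY l' i ▸ (h' i).2)

theorem mem_preimage_image_cell {z₀ z : Fin n → ℂ} :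
    z ∈ ComplexTorus.mk T ⁻¹' (ComplexTorus.mk T '' cell T z₀) ↔
      ∃ l, z - period T l ∈ cell T z₀ := by
  constructor
  · rintro ⟨w, hw, hwz⟩
    obtain ⟨l, rfl⟩ := ComplexTorus.exists_of_mk_eq hwz
    exact ⟨l, by simpa using hw⟩
  · rintro ⟨l, hl⟩
    refine ⟨_, hl, ?_⟩
    rw [← ComplexTorus.mk_add_period T l, sub_add_cancel]

open Classical in
/-- The equivariant extension of the sections `e^ψ e_j` over a cell. -/
noncomputable def extendSec (E : TorusBundle T N) (z₀ : Fin n → ℂ) (ψ : (Fin n → ℂ) → ℂ)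
    (j : Fin N) (z : Fin n → ℂ) : Fin N → ℂ :=
  if h : ∃ l, z - period T l ∈ cell T z₀ then
    Complex.exp (ψ (z - period T h.choose)) • (E.factor h.choose (z - period T h.choose)).col j
  else 0

/-- The lattice element picked by choice is the only one possible, so the extension is given by any
translate that lands in the cell. -/
theorem extendSec_eq (hT : (T.map Complex.im).det ≠ 0) (E : TorusBundle T N) {z₀ : Fin n → ℂ}
    (ψ : (Fin n → ℂ) → ℂ) (j : Fin N) {z : Fin n → ℂ} {l : (Fin n → ℤ) × (Fin n → ℤ)}
    (h : z - period T l ∈ cell T z₀) :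
    extendSec E z₀ ψ j z =
      Complex.exp (ψ (z - period T l)) • (E.factor l (z - period T l)).col j := by
  have hex : ∃ l, z - period T l ∈ cell T z₀ := ⟨l, h⟩
  rw [extendSec, dif_pos hex, eq_of_sub_period_mem_cell hT hex.choose_spec h]

theorem extendSec_eventuallyEq (hT : (T.map Complex.im).det ≠ 0) (E : TorusBundle T N)
    {z₀ : Fin n → ℂ} (ψ : (Fin n → ℂ) → ℂ) (j : Fin N) {z : Fin n → ℂ}
    {l : (Fin n → ℤ) × (Fin n → ℤ)} (h : z - period T l ∈ cell T z₀) :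
    extendSec E z₀ ψ j =ᶠ[nhds z]
      fun w => Complex.exp (ψ (w - period T l)) • (E.factor l (w - period T l)).col j := by
  have hopen : IsOpen ((fun w => w - period T l) ⁻¹' cell T z₀) :=
    (isOpen_cell T z₀).preimage (continuous_id.sub continuous_const)
  filter_upwards [hopen.mem_nhds h] with w hw using extendSec_eq hT E ψ j hw

/-- The local frame obtained by extending the sections `e^ψ e_j` over a cell. -/
noncomputable def extendFrame (hT : (T.map Complex.im).det ≠ 0) (E : TorusBundle T N)
    (z₀ : Fin n → ℂ) {ψ : (Fin n → ℂ) → ℂ} (hψ : ContDiff ℝ ∞ ψ) : E.LocalFrame where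
  base := ComplexTorus.mk T '' cell T z₀
  isOpen_base := QuotientAddGroup.isOpenMap_coe _ (isOpen_cell T z₀)
  sec := extendSec E z₀ ψ
  isSmoothSection j :=
    { smooth := by
        intro z hz
        obtain ⟨l, hl⟩ := mem_preimage_image_cell.mp hz
        have hsub : ContDiff ℝ ∞ fun w : Fin n → ℂ => w - period T l :=
          contDiff_id.sub contDiff_const
        have hs : ContDiff ℝ ∞ fun w =>
            Complex.exp (ψ (w - period T l)) • (E.factor l (w - period T l)).col j :=
          contDiff_pi.mpr fun i => (hψ.comp hsub).cexp.mul ((E.smooth l i j).comp hsub)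
        exact (hs.contDiffAt.congr_of_eventuallyEq
          (extendSec_eventuallyEq hT E ψ j hl)).contDiffWithinAt
      equivariant := by
        intro l' z hz
        obtain ⟨l, hl⟩ := mem_preimage_image_cell.mp hz
        have h1 : z + period T l' - period T (l' + l) = z - period T l := by
          rw [map_add]; abel
        -- The point of the cell is unchanged and the lattice element becomes `l' + l`; the cocycle
        -- identity splits off the factor of `l'`.
        rw [extendSec_eq hT E ψ j hl, extendSec_eq hT E ψ j (l := l' + l) (by rwa [h1]), h1,
          E.cocycle, sub_add_cancel, Matrix.mulVec_smul]
        rfl }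
  linearIndependent z hz := by
    obtain ⟨l, hl⟩ := mem_preimage_image_cell.mp hz
    have h := (Matrix.linearIndependent_cols_iff_isUnit.mpr
      (E.isUnit_factor l (z - period T l))).units_smul
      fun _ => Units.mk0 _ (Complex.exp_ne_zero (ψ (z - period T l)))
    have hfun : (fun j => extendSec E z₀ ψ j z) = _ := funext fun j => extendSec_eq hT E ψ j hl
    rw [hfun]
    exact h

/-! ### Parallel frames from a `∂̄`-primitive -/

namespace Connection

variable {D : E.Connection} {θ : (Fin n → ℂ) → (Fin n → ℂ) →ₗ[ℝ] ℂ}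

/-- With `y` the translate of `z` in the cell, `∂̄` of `e^ψ` contributes `-θ^{0,1}` at `y`, the
factor of automorphy contributes `θ^{0,1}` at `y` minus `θ^{0,1}` at `z`, and the connection form
contributes `θ^{0,1}` at `z`. The sum is zero, although `ψ` need not be periodic. -/
theorem derivBar_extendSec (hT : (T.map Complex.im).det ≠ 0)
    (hθ : ∀ z v, D.form z v = θ z v • 1) {ψ : (Fin n → ℂ) → ℂ} (hψ : ContDiff ℝ ∞ ψ)
    (hψθ : ∀ z v, dbar ψ z v = -formBar θ z v) {z₀ z : Fin n → ℂ}
    (hz : z ∈ ComplexTorus.mk T ⁻¹' (ComplexTorus.mk T '' cell T z₀)) (j : Fin N)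
    (v : Fin n → ℂ) : D.derivBar (extendSec E z₀ ψ j) z v = 0 := by
  have hdiff : DifferentiableAt ℝ (extendSec E z₀ ψ j) z :=
    (((extendFrame hT E z₀ hψ).isSmoothSection j).smooth.contDiffAt
      ((ComplexTorus.isOpen_mk_preimage (extendFrame hT E z₀ hψ).isOpen_base).mem_nhds
        hz)).differentiableAt (by simp)
  obtain ⟨l, hl⟩ := mem_preimage_image_cell.mp hz
  funext k
  have hev : (fun w => extendSec E z₀ ψ j w k) =ᶠ[nhds z]
      fun w => Complex.exp (ψ (w - period T l)) * E.factor l (w - period T l) k j := by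
    filter_upwards [extendSec_eventuallyEq hT E ψ j hl] with w hw
    rw [hw]
    rfl
  have hshift : ∀ g : (Fin n → ℂ) → ℂ,
      dbar (fun w => g (w - period T l)) z v = dbar g (z - period T l) v := by
    intro g
    simp only [dbar, fderiv_comp_sub]
  rw [derivBar_apply hθ hdiff, dbar_congr hev,
    hshift fun w => Complex.exp (ψ w) * E.factor l w k j, congrFun (extendSec_eq hT E ψ j hl) k]
  set y := z - period T l with hy
  have hzy : z = y + period T l := by rw [hy]; abel
  have hψd : HasFDerivAt ψ (fderiv ℝ ψ y) y := ((hψ.differentiable (by simp)) y).hasFDerivAt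
  have hF := hasFDerivAt_factor hθ l y k j
  have hexp := hψd.cexp
  rw [dbar_mul hexp.differentiableAt hF.differentiableAt]
  have h1 : dbar (fun w => Complex.exp (ψ w)) y v = Complex.exp (ψ y) * dbar ψ y v := by
    simp only [dbar, hexp.fderiv, smul_apply, smul_eq_mul]
    ring
  have h2 : dbar (fun w => E.factor l w k j) y v =
      E.factor l y k j * (formBar θ y v - formBar θ z v) := by
    simp only [dbar, hF.fderiv, smul_apply, smul_eq_mul, LinearMap.coe_toContinuousLinearMap',
      LinearMap.sub_apply, formBar, ← hzy]
    ring
  rw [h1, h2, hψθ]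
  simp only [Pi.smul_apply, Matrix.col_apply, smul_eq_mul, Pi.zero_apply]
  ring

/-- A connection with scalar connection form whose `(0,1)`-part is `∂̄`-exact is holomorphic. -/
theorem isHolomorphic_of_dbar_eq (hT : (T.map Complex.im).det ≠ 0)
    (hθ : ∀ z v, D.form z v = θ z v • 1) {ψ : (Fin n → ℂ) → ℂ} (hψ : ContDiff ℝ ∞ ψ)
    (hψθ : ∀ z v, dbar ψ z v = -formBar θ z v) : D.IsHolomorphic := by
  refine isHolomorphic_of_exists_frame hθ fun x => ?_
  obtain ⟨z₀, rfl⟩ := QuotientAddGroup.mk_surjective x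
  exact ⟨extendFrame hT E z₀ hψ, ⟨z₀, mem_cell_self T z₀, rfl⟩,
    fun j z hz v => derivBar_extendSec hT hθ hψ hψθ hz j v⟩

end Connection

end TorusBundle

/-! ### Connection forms that are affine in the base point -/

/-- The antilinear part of a real-linear form. -/
noncomputable def linBar {n : ℕ} (L : (Fin n → ℂ) →ₗ[ℝ] ℂ) (v : Fin n → ℂ) : ℂ :=
  (1 / 2 : ℂ) * (L v + Complex.I * L (Complex.I • v))

theorem contDiff_linearMap {n : ℕ} (L : (Fin n → ℂ) →ₗ[ℝ] ℂ) : ContDiff ℝ ∞ fun z => L z :=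
  (LinearMap.toContinuousLinearMap L).contDiff

theorem differentiableAt_linearMap {n : ℕ} (L : (Fin n → ℂ) →ₗ[ℝ] ℂ) (z : Fin n → ℂ) :
    DifferentiableAt ℝ (fun z => L z) z :=
  (LinearMap.toContinuousLinearMap L).differentiableAt

theorem dbar_linearMap {n : ℕ} (L : (Fin n → ℂ) →ₗ[ℝ] ℂ) (z v : Fin n → ℂ) :
    dbar (fun z => L z) z v = linBar L v := by
  have h : fderiv ℝ (fun z => L z) z = LinearMap.toContinuousLinearMap L :=
    (LinearMap.toContinuousLinearMap L).fderiv
  simp [dbar, linBar, h]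

theorem dbar_const {n : ℕ} (c : ℂ) (z v : Fin n → ℂ) : dbar (fun _ => c) z v = 0 := by
  simp [dbar]

theorem dbar_sum {n : ℕ} {ι : Type*} (s : Finset ι) {f : ι → (Fin n → ℂ) → ℂ} {z : Fin n → ℂ}
    (hf : ∀ i ∈ s, DifferentiableAt ℝ (f i) z) (v : Fin n → ℂ) :
    dbar (fun w => ∑ i ∈ s, f i w) z v = ∑ i ∈ s, dbar (f i) z v := by
  simp only [dbar, fderiv_fun_sum hf, sum_apply, Finset.mul_sum, ← Finset.sum_add_distrib]

/-- Real-linear coordinate forms `x_j`, `y_k` with `x + T y = F z`. -/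
structure IsCoordSystem {n : ℕ} (T F : Matrix (Fin n) (Fin n) ℂ)
    (x y : Fin n → (Fin n → ℂ) →ₗ[ℝ] ℂ) : Prop where
  add_eq : ∀ z j, x j z + ∑ k, T j k * y k z = (F *ᵥ z) j

namespace IsCoordSystem

variable {n : ℕ} {T F A : Matrix (Fin n) (Fin n) ℂ} {x y : Fin n → (Fin n → ℂ) →ₗ[ℝ] ℂ}
  {κ : ℂ} {μ : Fin n → ℂ} {θ : (Fin n → ℂ) → (Fin n → ℂ) →ₗ[ℝ] ℂ}

/-- The combination `x + T y = F z` is complex linear, so its antilinear part vanishes. -/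
theorem linBar_fst (h : IsCoordSystem T F x y) (v : Fin n → ℂ) (j : Fin n) :
    linBar (x j) v = -∑ k, T j k * linBar (y k) v := by
  have h1 := h.add_eq v j
  have h2 := h.add_eq (Complex.I • v) j
  rw [Matrix.mulVec_smul, Pi.smul_apply, ← h1, smul_eq_mul] at h2
  have h3 : ∑ k, T j k * linBar (y k) v = (1 / 2 : ℂ) * (∑ k, T j k * y k v +
      Complex.I * ∑ k, T j k * y k (Complex.I • v)) := by
    simp only [linBar, Finset.mul_sum, ← Finset.sum_add_distrib]
    exact Finset.sum_congr rfl fun k _ => by ring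
  rw [h3, linBar]
  linear_combination (1 / 2 * Complex.I) * h2 +
    (1 / 2 * (x j v + ∑ k, T j k * y k v)) * Complex.I_mul_I

theorem formBar_eq (hθ : ∀ z v, θ z v = κ * ∑ i, (∑ j, A i j * x j z + μ i) * y i v)
    (z v : Fin n → ℂ) : TorusBundle.Connection.formBar θ z v =
      κ * ∑ i, (∑ j, A i j * x j z + μ i) * linBar (y i) v := by
  simp only [TorusBundle.Connection.formBar, hθ, linBar, Finset.mul_sum,
    ← Finset.sum_add_distrib]
  exact Finset.sum_congr rfl fun i _ => by ring

/-- Only the coefficients `x j` depend on the base point, and `linBar_fst` trades their antilinear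
parts for those of `y`. The result is independent of `z`, and antisymmetrizing it in `u` and `v`
gives the `(0,2)`-curvature. -/
theorem dbar_formBar (h : IsCoordSystem T F x y)
    (hθ : ∀ z v, θ z v = κ * ∑ i, (∑ j, A i j * x j z + μ i) * y i v) (z u v : Fin n → ℂ) :
    dbar (fun w => TorusBundle.Connection.formBar θ w v) z u =
      -κ * ∑ i, linBar (y i) v * ∑ k, (A * T) i k * linBar (y k) u := by
  have hx : ∀ i j, DifferentiableAt ℝ (fun w => A i j * x j w) z := fun i j =>
    (differentiableAt_linearMap _ z).const_mul _
  have hs : ∀ i, DifferentiableAt ℝ (fun w => ∑ j, A i j * x j w) z := fun i =>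
    DifferentiableAt.fun_sum fun j _ => hx i j
  have hi : ∀ i, DifferentiableAt ℝ (fun w => ∑ j, A i j * x j w + μ i) z := fun i =>
    (hs i).add_const _
  simp only [formBar_eq hθ]
  rw [dbar_const_mul (DifferentiableAt.fun_sum fun i _ => (hi i).mul_const _),
    dbar_sum _ fun i _ => (hi i).mul_const _, neg_mul, ← mul_neg, ← Finset.sum_neg_distrib]
  congr 1
  refine Finset.sum_congr rfl fun i _ => ?_
  rw [dbar_mul (hi i) (differentiableAt_const _), dbar_const, dbar_add (hs i)
    (differentiableAt_const _), dbar_const, dbar_sum _ fun j _ => hx i j, mul_zero, zero_add,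
    add_zero, ← mul_neg, ← Finset.sum_neg_distrib]
  congr 1
  simp only [dbar_const_mul (differentiableAt_linearMap _ z), dbar_linearMap, h.linBar_fst, mul_neg,
    Finset.sum_neg_distrib, Matrix.mul_apply, Finset.mul_sum, Finset.sum_mul]
  rw [Finset.sum_comm]
  simp only [mul_assoc]

/-- A quadratic `∂̄`-primitive of the `(0,1)`-part of the connection form. -/
noncomputable def primitive (T F A : Matrix (Fin n) (Fin n) ℂ)
    (y : Fin n → (Fin n → ℂ) →ₗ[ℝ] ℂ) (κ : ℂ) (μ : Fin n → ℂ) (z : Fin n → ℂ) : ℂ :=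
  κ * ∑ i, (∑ j, (1 / 2 * (A * T) i j) * y j z + (-((A * F) *ᵥ z) i + -μ i)) * y i z

theorem contDiff_primitive : ContDiff ℝ ∞ (primitive T F A y κ μ) := by
  refine contDiff_const.mul (ContDiff.sum fun i _ => ContDiff.mul (ContDiff.add
    (ContDiff.sum fun j _ => contDiff_const.mul (contDiff_linearMap _))
    (ContDiff.add (ContDiff.neg ?_) contDiff_const)) (contDiff_linearMap _))
  exact contDiff_pi.mp (contDiff_matrix_mulVec (A * F)) i

/-- Substituting `A x = A F z - A T y` leaves a term holomorphic in `z` times `y`, integrated by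
multiplying with `y`, and a term quadratic in `y`. Symmetry of `A T` is what makes half the
quadratic form `yᵗ A T y` a primitive of the latter. -/
theorem dbar_primitive (h : IsCoordSystem T F x y)
    (hθ : ∀ z v, θ z v = κ * ∑ i, (∑ j, A i j * x j z + μ i) * y i v)
    (hsymm : A * T = (A * T)ᵀ) (z v : Fin n → ℂ) :
    dbar (primitive T F A y κ μ) z v = -TorusBundle.Connection.formBar θ z v := by
  have hB : ∀ i j, (A * T) i j = (A * T) j i := fun i j => congrFun (congrFun hsymm i) j
  have hy : ∀ i, DifferentiableAt ℝ (fun w => y i w) z := fun i => differentiableAt_linearMap _ z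
  have hby : ∀ i j, DifferentiableAt ℝ (fun w => (1 / 2 * (A * T) i j) * y j w) z := fun i j =>
    (hy j).const_mul _
  have hs : ∀ i, DifferentiableAt ℝ (fun w => ∑ j, (1 / 2 * (A * T) i j) * y j w) z := fun i =>
    DifferentiableAt.fun_sum fun j _ => hby i j
  have hF : ∀ i, DifferentiableAt ℂ (fun w => -((A * F) *ᵥ w) i + -μ i) z := fun i =>
    ((differentiableAt_pi.mp
      (LinearMap.toContinuousLinearMap (A * F).mulVecLin).differentiableAt i).neg).add_const _
  have hF' : ∀ i, DifferentiableAt ℝ (fun w => -((A * F) *ᵥ w) i + -μ i) z := fun i =>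
    (hF i).restrictScalars ℝ
  have hQ : ∀ i, DifferentiableAt ℝ (fun w => ∑ j, (1 / 2 * (A * T) i j) * y j w +
      (-((A * F) *ᵥ w) i + -μ i)) z := fun i => (hs i).add (hF' i)
  unfold primitive
  rw [dbar_const_mul (DifferentiableAt.fun_sum fun i _ => (hQ i).fun_mul (hy i)),
    dbar_sum _ fun i _ => (hQ i).fun_mul (hy i), formBar_eq hθ, ← mul_neg]
  congr 1
  have hterm : ∀ i, dbar (fun w => (∑ j, (1 / 2 * (A * T) i j) * y j w +
      (-((A * F) *ᵥ w) i + -μ i)) * y i w) z v =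
      (∑ j, (1 / 2 * (A * T) i j) * y j z) * linBar (y i) v +
        ∑ j, (1 / 2 * (A * T) i j) * linBar (y j) v * y i z +
        (-((A * F) *ᵥ z) i + -μ i) * linBar (y i) v := by
    intro i
    rw [dbar_mul (hQ i) (hy i), dbar_add (hs i) (hF' i), dbar_eq_zero_of_differentiableAt (hF i),
      dbar_sum _ fun j _ => hby i j]
    simp only [dbar_const_mul (hy _), dbar_linearMap, ← Finset.sum_mul]
    ring
  have hAF : ∀ i, ((A * F) *ᵥ z) i = ∑ j, A i j * x j z + ∑ j, (A * T) i j * y j z := by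
    intro i
    rw [← Matrix.mulVec_mulVec, Matrix.mulVec, dotProduct]
    simp only [← h.add_eq z, mul_add, Finset.sum_add_distrib, Matrix.mul_apply, Finset.mul_sum,
      Finset.sum_mul]
    congr 1
    rw [Finset.sum_comm]
    simp only [mul_assoc]
  have hswap : ∑ i, ∑ j, (1 / 2 * (A * T) i j) * linBar (y j) v * y i z =
      ∑ i, (∑ j, (1 / 2 * (A * T) i j) * y j z) * linBar (y i) v := by
    rw [Finset.sum_comm]
    refine Finset.sum_congr rfl fun i _ => ?_
    rw [Finset.sum_mul]
    refine Finset.sum_congr rfl fun j _ => ?_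
    rw [hB j i]
    ring
  simp only [hterm, Finset.sum_add_distrib]
  rw [hswap, ← Finset.sum_add_distrib, ← Finset.sum_add_distrib, ← Finset.sum_neg_distrib]
  refine Finset.sum_congr rfl fun i _ => ?_
  rw [hAF i]
  simp only [mul_assoc, ← Finset.mul_sum]
  ring

/-- If the constant `(0,2)`-part of the curvature vanishes, then `A T` is symmetric. -/
theorem symm_of_dbar_formBar_sub_eq_zero (h : IsCoordSystem T F x y)
    (hθ : ∀ z v, θ z v = κ * ∑ i, (∑ j, A i j * x j z + μ i) * y i v) (hκ : κ ≠ 0)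
    (hy : ∀ a, ∃ u, ∀ i, linBar (y i) u = (Pi.single a 1 : Fin n → ℂ) i)
    (hc : ∀ u v, dbar (fun w => TorusBundle.Connection.formBar θ w v) 0 u -
      dbar (fun w => TorusBundle.Connection.formBar θ w u) 0 v = 0) : A * T = (A * T)ᵀ := by
  ext a b
  -- Vectors dual to the antilinear parts of the `y i` isolate the entries `(a, b)` and `(b, a)` of
  -- `A * T`.
  obtain ⟨u, hu⟩ := hy a
  obtain ⟨v, hv⟩ := hy b
  have h1 := hc u v
  rw [h.dbar_formBar hθ, h.dbar_formBar hθ] at h1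
  simp only [hu, hv] at h1
  simp only [Pi.single_apply, mul_ite, mul_one, mul_zero, ite_mul, one_mul, zero_mul,
    Finset.sum_ite_eq', Finset.mem_univ, if_true] at h1
  rw [Matrix.transpose_apply]
  refine mul_left_cancel₀ hκ ?_
  linear_combination h1

end IsCoordSystem

/-! ### The pulled-back bundle -/

/-- The coordinate `x_j (F z)`, for `z = x + T y`, as a complex-valued form. -/
noncomputable def pullX {n : ℕ} (T F : Matrix (Fin n) (Fin n) ℂ) (j : Fin n) :
    (Fin n → ℂ) →ₗ[ℝ] ℂ :=
  Complex.ofRealCLM.toLinearMap ∘ₗ LinearMap.proj j ∘ₗ coordX T ∘ₗ F.mulVecLin.restrictScalars ℝ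

/-- The coordinate `y_j (F z)`, for `z = x + T y`, as a complex-valued form. -/
noncomputable def pullY {n : ℕ} (T F : Matrix (Fin n) (Fin n) ℂ) (j : Fin n) :
    (Fin n → ℂ) →ₗ[ℝ] ℂ :=
  Complex.ofRealCLM.toLinearMap ∘ₗ LinearMap.proj j ∘ₗ coordY T ∘ₗ F.mulVecLin.restrictScalars ℝ

theorem pullX_apply {n : ℕ} (T F : Matrix (Fin n) (Fin n) ℂ) (j : Fin n) (z : Fin n → ℂ) :
    pullX T F j z = (coordX T (F *ᵥ z) j : ℂ) := rfl

theorem pullY_apply {n : ℕ} (T F : Matrix (Fin n) (Fin n) ℂ) (j : Fin n) (z : Fin n → ℂ) :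
    pullY T F j z = (coordY T (F *ᵥ z) j : ℂ) := rfl

theorem isCoordSystem_pull {n : ℕ} {T : Matrix (Fin n) (Fin n) ℂ}
    (hT : (T.map Complex.im).det ≠ 0) (F : Matrix (Fin n) (Fin n) ℂ) :
    IsCoordSystem T F (pullX T F) (pullY T F) :=
  ⟨fun z j => congrFun (coordX_add_mulVec_coordY T hT (F *ᵥ z)) j⟩

theorem exists_linBar_pullY_eq_single {n : ℕ} {T F : Matrix (Fin n) (Fin n) ℂ}
    (hT : (T.map Complex.im).det ≠ 0) (hF : IsUnit F.det) (a : Fin n) :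
    ∃ u, ∀ i, linBar (pullY T F i) u = (Pi.single a 1 : Fin n → ℂ) i := by
  -- The purely imaginary vector `w = i t` has `y`-coordinate `(Im T)⁻¹ t`, while `i w` is real and
  -- has `y`-coordinate zero. The entry `2` compensates the factor `1/2` in `linBar`.
  let t : Fin n → ℝ := T.map Complex.im *ᵥ Pi.single a 2
  let w : Fin n → ℂ := fun i => Complex.I * t i
  have hw : F *ᵥ (F⁻¹ *ᵥ w) = w := by
    rw [Matrix.mulVec_mulVec, Matrix.mul_nonsing_inv _ hF, Matrix.one_mulVec]
  have h1 : coordY T w = Pi.single a 2 := by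
    have h : (Complex.imLm.compLeft (Fin n)) w = t := by
      funext i
      simp [w]
    simp only [coordY, LinearMap.comp_apply, h, Matrix.mulVecLin_apply, t, Matrix.mulVec_mulVec]
    rw [Matrix.nonsing_inv_mul _ (isUnit_iff_ne_zero.mpr hT), Matrix.one_mulVec]
  have h2 : coordY T (Complex.I • w) = 0 := by
    have h : (Complex.imLm.compLeft (Fin n)) (Complex.I • w) = 0 := by
      funext i
      simp [w]
    simp only [coordY, LinearMap.comp_apply, h, map_zero]
  refine ⟨F⁻¹ *ᵥ w, fun i => ?_⟩
  rw [linBar, pullY_apply, pullY_apply, Matrix.mulVec_smul, hw, h1, h2]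
  rcases eq_or_ne i a with rfl | hi
  · simp
  · simp [hi]

/-- The scalar form of the pulled-back connection. -/
noncomputable def pullForm {n : ℕ} (T F : Matrix (Fin n) (Fin n) ℂ) (A : Matrix (Fin n) (Fin n) ℤ)
    (κ : ℂ) (μ : Fin n → ℂ) (z : Fin n → ℂ) : (Fin n → ℂ) →ₗ[ℝ] ℂ :=
  κ • ∑ i, (∑ j, (A.map (Int.cast : ℤ → ℂ)) i j * pullX T F j z + μ i) • pullY T F i

theorem pullForm_apply {n : ℕ} (T F : Matrix (Fin n) (Fin n) ℂ) (A : Matrix (Fin n) (Fin n) ℤ)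
    (κ : ℂ) (μ : Fin n → ℂ) (z v : Fin n → ℂ) : pullForm T F A κ μ z v =
      κ * ∑ i, (∑ j, (A.map (Int.cast : ℤ → ℂ)) i j * pullX T F j z + μ i) * pullY T F i v := by
  simp [pullForm]

theorem form_pullback_connectionE {n r N : ℕ} {T T' : Matrix (Fin n) (Fin n) ℂ}
    (hT' : (T'.map Complex.im).det ≠ 0) (A : Matrix (Fin n) (Fin n) ℤ) (S : UnitarySystem r A N)
    (μ : Fin n → ℂ) (φ : TorusHom T T') (z v : Fin n → ℂ) :
    ((connectionE T' hT' A S μ).pullback φ).form z v =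
      pullForm T' φ.lin A (-(Complex.I / (2 * Real.pi)) * (1 / r)) μ z v •
        (1 : Matrix (Fin N) (Fin N) ℂ) := by
  rw [pullForm_apply]
  simp only [TorusBundle.Connection.pullback, connectionE, LinearMap.comp_apply, LinearMap.coe_mk,
    AddHom.coe_mk, pullX_apply, pullY_apply, Matrix.map_apply, LinearMap.restrictScalars_apply,
    Matrix.mulVecLin_apply]
  congr 1
  rw [mul_assoc]
  congr 1
  rw [Finset.mul_sum]
  refine Finset.sum_congr rfl fun i _ => ?_
  rw [← mul_add, mul_assoc]
  congr 3
  exact Finset.sum_congr rfl fun j _ => mul_comm _ _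

theorem IsReducedRank.pos {n r N : ℕ} {A : Matrix (Fin n) (Fin n) ℤ} (h : IsReducedRank r A N) :
    0 < N := by
  obtain ⟨_, _, d, _, _, rfl⟩ := h
  exact Finset.prod_pos fun i _ => Rat.den_pos _

theorem ImPosDef.det_im_ne_zero {n : ℕ} {T : Matrix (Fin n) (Fin n) ℂ} (hT : ImPosDef T) :
    (T.map Complex.im).det ≠ 0 := by
  intro h
  obtain ⟨v, hv, h0⟩ := Matrix.exists_mulVec_eq_zero_iff.mpr h
  have := hT v hv
  simp [h0] at this

/-! ### The equivalence, by a cycle of implications -/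

theorem proposition4p3 {n : ℕ} (T : Matrix (Fin n) (Fin n) ℂ) (hT : ImPosDef T)
    (δ : Matrix (Fin n) (Fin n) ℤ) (hδ : (T - δ.map (Int.cast : ℤ → ℂ)).det ≠ 0)
    (r : ℕ) (hr : 0 < r) (A : Matrix (Fin n) (Fin n) ℤ) (p q : Fin n → ℝ)
    (N : ℕ) (hN : IsReducedRank r A N) (S : UnitarySystem r A N) :
    let T' := dualPeriod T δ
    let hT' := dualPeriod_im_det_ne_zero hT hδ
    let μ : Fin n → ℂ := (fun i => (p i : ℂ)) + T'ᵀ *ᵥ fun i => (q i : ℂ)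
    (((connectionE T' hT' A S μ).pullback (phi T δ hδ)).IsHolomorphic ↔
      A.map (Int.cast : ℤ → ℂ) * T' = (A.map (Int.cast : ℤ → ℂ) * T')ᵀ) ∧
    (((bundleE T' hT' A S).pullback (phi T δ hδ)).AdmitsHolomorphicStructure ↔
      A.map (Int.cast : ℤ → ℂ) * T' = (A.map (Int.cast : ℤ → ℂ) * T')ᵀ) := by
  intro T' hT' μ
  have hform := form_pullback_connectionE hT' A S μ (phi T δ hδ)
  have hcoord := isCoordSystem_pull hT' (phi T δ hδ).lin
  have hθ := pullForm_apply T' (phi T δ hδ).lin A (-(Complex.I / (2 * Real.pi)) * (1 / r)) μ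
  have h1 : ((connectionE T' hT' A S μ).pullback (phi T δ hδ)).IsHolomorphic →
      ((bundleE T' hT' A S).pullback (phi T δ hδ)).AdmitsHolomorphicStructure :=
    fun ⟨H, _⟩ => ⟨H⟩
  have h2 : ((bundleE T' hT' A S).pullback (phi T δ hδ)).AdmitsHolomorphicStructure →
      A.map (Int.cast : ℤ → ℂ) * T' = (A.map (Int.cast : ℤ → ℂ) * T')ᵀ := by
    intro hE
    have hF : IsUnit (phi T δ hδ).lin.det :=
      Matrix.isUnit_nonsing_inv_det _ (isUnit_det_neg_add hδ)
    have hκ : -(Complex.I / (2 * Real.pi)) * (1 / r : ℂ) ≠ 0 := by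
      have hpi : (Real.pi : ℂ) ≠ 0 := by exact_mod_cast Real.pi_ne_zero
      have hr' : (r : ℂ) ≠ 0 := by exact_mod_cast hr.ne'
      simp [hpi, hr']
    refine hcoord.symm_of_dbar_formBar_sub_eq_zero hθ hκ (exists_linBar_pullY_eq_single hT' hF)
      fun u v => ?_
    refine TorusBundle.Connection.eq_zero_of_admitsHolomorphicStructure hT.det_im_ne_zero hN.pos
      hform hE (u := u) (v := v) fun z => ?_
    -- The formula for the `(0,2)`-curvature does not involve the base point, so its value at `0`
    -- serves as the constant.
    exact congrArg₂ (· - ·)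
      ((hcoord.dbar_formBar hθ z u v).trans (hcoord.dbar_formBar hθ 0 u v).symm)
      ((hcoord.dbar_formBar hθ z v u).trans (hcoord.dbar_formBar hθ 0 v u).symm)
  have h3 : A.map (Int.cast : ℤ → ℂ) * T' = (A.map (Int.cast : ℤ → ℂ) * T')ᵀ →
      ((connectionE T' hT' A S μ).pullback (phi T δ hδ)).IsHolomorphic := fun hsymm =>
    TorusBundle.Connection.isHolomorphic_of_dbar_eq hT.det_im_ne_zero hform
      IsCoordSystem.contDiff_primitive (hcoord.dbar_primitive hθ hsymm)
  exact ⟨⟨h2 ∘ h1, h3⟩, ⟨h2, h1 ∘ h3⟩⟩
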